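/- **Conventions.** Let $n\ge 0$. A semigroup $G\subset\mathbb Z\times\mathbb Z^n$ is *graded* if it lies in the half-space $h\ge 0$ ($h$ = first coordinate, the *degree*) and its set $G(d)$ of elements of degree $d$ is non-empty for every $d\ge 1$. It has *finite sections* if $H_G(d):=\#G(d)<\infty$ for all $d\ge 1$; *limited growth* if it has finite sections and $H_G(d)<q\,d^n$ for all $d\ge1$ with some constant $q$; *complete rank* if it generates a subgroup of finite index in $\mathbb Z\times\mathbb Z^n$. Let $V\subset\mathbb R\times\mathbb R^n$ be a linear subspace. A *positive cone* of $V$ is a closed convex cone $C\subset V$ with $\dim C=\dim V$, contained in $\{h\ge0\}$ and with $C\cap\{h=0\}=\{0\}$. Given a subgroup $N\subset\mathbb Z^n$ (the lattice of $V$ at height $0$), a positive cone $C$ of $V$, a subgroup $T\subset N$ of finite index and an integral point $A\in V$ with $h(A)=1$, the *semigroup of type $(C,T,A)$ in $V$* is $S=C\cap(\mathbb ZA+T)$, where $T\subset\mathbb Z^n=\{0\}\times\mathbb Z^n$. It *approximates* $G$ if $G\subset S$ and $r_{G,S}(d)/d\to0$ as $d\to\infty$, where $r_{G,S}(d)$ is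 the largest distance from a point of $S(d)\setminus G(d)$ to the boundary of $C\cap\{h=d\}$ in $V\cap\{h=d\}$ ($r_{G,S}(d)=0$ if $S(d)=G(d)$). When $V$ is not mentioned, $V=\mathbb R\times\mathbb R^n$ and $N=\mathbb Z^n$. **Theorem.** (a) Let $G\subset\mathbb Z\times\mathbb Z^n$ be a graded semigroup of complete rank and limited growth. Then $G$ is contained in a positive cone of $\mathbb R\times\mathbb R^n$, and there is exactly one semigroup $S\subset\mathbb Z\times\mathbb Z^n$ that is of some type $(C,T,A)$ and approximates $G$. (b) Let $G\subset\mathbb Z\times\mathbb Z^n$ be a graded semigroup contained in a graded semigroup of complete rank and limited growth. Let $T=T(G)$ be the intersection of the group generated by $G$ with $\mathbb Z^n=\{0\}\times\mathbb Z^n$, let $k$ be its rank, and let $M\subset\mathbb Z^n$ be the group of all $m$ with $lm\in T$ for some integer $l\ge1$. Let $C(G)$ be the closure of the convex hull of $G\cup\{0\}$, and let $\Delta(G)=\{x\in\mathbb R^n:(1,x)\in C(G)\}$ be the Newton convex body of $G$. Then $\Delta(G)$ is a non-empty compact convex set of dimension $k$, $G$ has finite sections, and $M\cong\mathbb Z^k$.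 Moreover, let $A\in G$ be any element of degree $1$ and let $V(G)$ be the real vector space spanned by $A$ and $\{0\}\times M$. Then $\dim V(G)=k+1$, $C(G)$ is a positive cone of $V(G)$ (in particular of maximal dimension in $V(G)$), the semigroup of type $(C(G),T,A)$ in $V(G)$, with lattice $N=M$ at height $0$, is defined (so $[M:T]<\infty$) and approximates $G$, and $$\lim_{d\to\infty}\frac{H_G(d)}{d^k}=\frac{V_k(\Delta(G))}{[M:T]},$$ where $V_k$ is the $k$-dimensional volume on the translate of $\mathbb R M$ containing $\Delta(G)$, normalised so that a fundamental parallelepiped of the lattice $M$ has volume $1$. -/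

import Mathlib

open Filter Topology MeasureTheory

noncomputable section

namespace NewtonBody

/-- The lattice `ℤ × ℤⁿ`; the first coordinate is the degree. -/
abbrev IntPts (n : ℕ) : Type := ℤ × (Fin n → ℤ)

/-- The space `ℝ × ℝⁿ`. Two points with the same first coordinate `h` are at Euclidean distance in
the hyperplane `{h} × ℝⁿ`. -/
abbrev RealPts (n : ℕ) : Type := ℝ × EuclideanSpace ℝ (Fin n)

/-- The inclusion `ℤⁿ ⊂ ℝⁿ`. -/
def realVec {n : ℕ} (m : Fin n → ℤ) : EuclideanSpace ℝ (Fin n) :=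
  WithLp.toLp 2 (fun i => (m i : ℝ))

/-- The inclusion `ℤ × ℤⁿ ⊂ ℝ × ℝⁿ`. -/
def realPt {n : ℕ} (p : IntPts n) : RealPts n := ((p.1 : ℝ), realVec p.2)

section Semigroup

variable {n : ℕ}

/-- A graded semigroup: contained in the half-space `h ≥ 0`, with elements of every degree
`d = 1, 2, …`. -/
def IsGraded (G : AddSubsemigroup (IntPts n)) : Prop :=
  (∀ p ∈ G, 0 ≤ p.1) ∧ ∀ d : ℕ, 0 < d → ∃ m : Fin n → ℤ, ((d : ℤ), m) ∈ G

/-- The elements of degree `d`. -/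
def degPart (G : AddSubsemigroup (IntPts n)) (d : ℕ) : Set (IntPts n) :=
  {p | p ∈ G ∧ p.1 = (d : ℤ)}

def FiniteSections (G : AddSubsemigroup (IntPts n)) : Prop :=
  ∀ d : ℕ, 0 < d → (degPart G d).Finite

/-- The Hilbert function (meaningful for finite sections). -/
def hilbert (G : AddSubsemigroup (IntPts n)) (d : ℕ) : ℕ := (degPart G d).ncard

def LimitedGrowth (G : AddSubsemigroup (IntPts n)) : Prop :=
  FiniteSections G ∧ ∃ q : ℝ, ∀ d : ℕ, 0 < d → (hilbert G d : ℝ) < q * (d : ℝ) ^ n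

/-- The subgroup generated by `G`. -/
def genGroup (G : AddSubsemigroup (IntPts n)) : AddSubgroup (IntPts n) :=
  AddSubgroup.closure (G : Set (IntPts n))

/-- The generated subgroup has finite index in `ℤ × ℤⁿ`. -/
def CompleteRank (G : AddSubsemigroup (IntPts n)) : Prop := (genGroup G).FiniteIndex

/-- `T(G)`: the intersection of the generated subgroup with `ℤⁿ = {0} × ℤⁿ`. -/
def groupT (G : AddSubsemigroup (IntPts n)) : AddSubgroup (Fin n → ℤ) :=
  (genGroup G).comap (AddMonoidHom.inr ℤ (Fin n → ℤ))

/-- The elements of `ℤⁿ` of which some positive multiple lies in `T`. -/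
def saturation (T : AddSubgroup (Fin n → ℤ)) : AddSubgroup (Fin n → ℤ) where
  carrier := {m | ∃ l : ℕ, 0 < l ∧ l • m ∈ T}
  zero_mem' := ⟨1, one_pos, by simp⟩
  add_mem' := by
    rintro x y ⟨l, hl, hx⟩ ⟨l', hl', hy⟩
    refine ⟨l * l', Nat.mul_pos hl hl', ?_⟩
    rw [smul_add]
    refine T.add_mem ?_ ?_
    · rw [mul_comm, mul_smul]
      exact T.nsmul_mem hx l'
    · rw [mul_smul]
      exact T.nsmul_mem hy l
  neg_mem' := by
    rintro x ⟨l, hl, hx⟩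
    exact ⟨l, hl, by rw [smul_neg]; exact T.neg_mem hx⟩

/-- `M(G)`: the saturation of `T(G)` in `ℤⁿ`. -/
def groupM (G : AddSubsemigroup (IntPts n)) : AddSubgroup (Fin n → ℤ) := saturation (groupT G)

/-- The space `V(G)`: the real subspace spanned by the group generated by `A` and `{0} × M(G)`. -/
def spaceV (G : AddSubsemigroup (IntPts n)) (A : IntPts n) : Submodule ℝ (RealPts n) :=
  Submodule.span ℝ (realPt ''
    ((AddSubgroup.zmultiples A ⊔ (groupM G).map (AddMonoidHom.inr ℤ (Fin n → ℤ)) :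
      AddSubgroup (IntPts n)) : Set (IntPts n)))

/-- `C(G)`: the closure of the convex hull of `G ∪ {0}`. -/
def coneC (G : AddSubsemigroup (IntPts n)) : Set (RealPts n) :=
  closure (convexHull ℝ (realPt '' (G : Set (IntPts n)) ∪ {0}))

/-- The Newton convex body `Δ(G) = C(G) ∩ {h = 1}`, as a subset of `ℝⁿ`. -/
def newtonBody (G : AddSubsemigroup (IntPts n)) : Set (EuclideanSpace ℝ (Fin n)) :=
  {x | ((1 : ℝ), x) ∈ coneC G}

/-- `C` is a positive cone of the subspace `V`: a closed convex cone in `V`, of the dimension of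
`V`, contained in the half-space `h ≥ 0` and meeting `h = 0` only in the origin.
Positive cones of `ℝ × ℝⁿ` are obtained for `V = ⊤`. -/
structure IsPositiveCone (V : Submodule ℝ (RealPts n)) (C : Set (RealPts n)) : Prop where
  isClosed : IsClosed C
  convex : Convex ℝ C
  smul_mem : ∀ r : ℝ, 0 ≤ r → ∀ x ∈ C, r • x ∈ C
  span_eq : Submodule.span ℝ C = V
  nonneg : ∀ x ∈ C, 0 ≤ x.1
  inter_eq : C ∩ {x | x.1 = 0} = {0}

/-- `G` is contained in a positive cone of `ℝ × ℝⁿ`. -/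
def ConicType (G : AddSubsemigroup (IntPts n)) : Prop :=
  ∃ C : Set (RealPts n), IsPositiveCone ⊤ C ∧ realPt '' (G : Set (IntPts n)) ⊆ C

/-- The lattice points in the cone `C` that lie in the subgroup `{l A + t | l ∈ ℤ, t ∈ T}`. -/
def typeSet (C : Set (RealPts n)) (T : AddSubgroup (Fin n → ℤ)) (A : IntPts n) : Set (IntPts n) :=
  {p | realPt p ∈ C ∧ ∃ l : ℤ, ∃ t ∈ T, p = l • A + (0, t)}

/-- `S` has type `(C, T, A)` in the space `V`, whose lattice at height `0` is `N`: here `C` is a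
positive cone of `V`, `T` has finite index in `N`, and `A` is an integral point of `V` with first
coordinate `1`. The case of `ℝ × ℝⁿ` is `V = ⊤`, `N = ⊤`. -/
structure HasType (V : Submodule ℝ (RealPts n)) (N : AddSubgroup (Fin n → ℤ)) (C : Set (RealPts n))
    (T : AddSubgroup (Fin n → ℤ)) (A : IntPts n) (S : Set (IntPts n)) : Prop where
  cone : IsPositiveCone V C
  le : T ≤ N
  finiteIndex : T.relIndex N ≠ 0
  mem : realPt A ∈ V
  degree : A.1 = 1
  eq : S = typeSet C T A

/-- The boundary of the section `C(d) = C ∩ {h = d}` in the hyperplane `V ∩ {h = d}` of `V`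
(for `C` closed and contained in `V`). -/
def sectionBoundary (V : Submodule ℝ (RealPts n)) (C : Set (RealPts n)) (d : ℕ) : Set (RealPts n) :=
  {x | x ∈ C ∧ x.1 = (d : ℝ)} ∩ closure {x | x ∈ V ∧ x.1 = (d : ℝ) ∧ x ∉ C}

/-- The largest distance from a point of `S(d) \ G(d)` to the boundary of the section `C(d)`;
it is `0` if `S(d) = G(d)`. -/
def defect (V : Submodule ℝ (RealPts n)) (C : Set (RealPts n)) (S : Set (IntPts n))
    (G : AddSubsemigroup (IntPts n)) (d : ℕ) : ENNReal :=
  ⨆ p ∈ {p : IntPts n | p ∈ S ∧ p ∉ G ∧ p.1 = (d : ℤ)},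
    Metric.infEDist (realPt p) (sectionBoundary V C d)

/-- `S` (of some type `(C, T, A)` in `V`) approximates `G`. -/
def Approximates (V : Submodule ℝ (RealPts n)) (C : Set (RealPts n)) (S : Set (IntPts n))
    (G : AddSubsemigroup (IntPts n)) : Prop :=
  (G : Set (IntPts n)) ⊆ S ∧
    Tendsto (fun d : ℕ => defect V C S G d / (d : ENNReal)) atTop (𝓝 0)

/-- The volume of a subset `X` of the affine space `a + span N ⊂ ℝⁿ`, normalised so that the
fundamental parallelepiped of the lattice `N` has volume `1`: Lebesgue measure in the affine
coordinates with origin `a` given by the `ℤ`-basis `b` of `N`. -/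
def latticeVolume {k : ℕ} {N : AddSubgroup (Fin n → ℤ)} (b : Module.Basis (Fin k) ℤ N)
    (a : EuclideanSpace ℝ (Fin n)) (X : Set (EuclideanSpace ℝ (Fin n))) : ENNReal :=
  volume {c : Fin k → ℝ | a + ∑ i, c i • realVec (b i : Fin n → ℤ) ∈ X}

end Semigroup

end NewtonBody

end

open NewtonBody

open Filter Topology MeasureTheory
open scoped Pointwise

set_option linter.unusedSectionVars false

/-! Fix an element `A` of degree 1. Subtracting `d A` from the degree `d` elements and taking
coordinates in a basis of `groupM G` turns `G` into sets `P d ⊆ ℝᵏ` containing `0`, with `P d + P e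
⊆ P (d + e)`, which generate the lattice `L` of coordinates of `groupT G`. The closed convex hull of
all the points `x / d`, `x ∈ P d`, is the Newton body in these coordinates.

The core is `IsGradedFamily.exists_nhds_mem`: near an interior point of this hull, `P d` contains
every point of `L` scaled by `1/d`, once `d` is large. Such a point is a real nonnegative
combination of finitely many elements of the family. Rounding the coefficients down leaves an error
in a finite subset of `L`, and one fixed element absorbs all these errors at a fixed cost in degree.
By compactness the statement becomes uniform on compact sets of interior points.

Three consequences follow. Limited growth bounds the volume of convex compact sets inside the hull,
so the hull is bounded and `G` lies in a cone `‖m‖ ≤ R h` (`exists_linear_bound`); subsemigroups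
inherit this bound. Points of `S` missing from `G` stay close to the boundary of the section
relative to `d` (`approximates_coneC`). Counting lattice points in convex bodies gives the Hilbert
asymptotics, with covolume `[M : T]` (`tendsto_hilbert_div`).

For uniqueness, an approximated `G` contains all points of `S` of large degree near an interior ray
of `C`. Hence `G` determines both the group `ℤA + T` and the cone `C` (`genGroup_eq`, `eq_coneC`).
-/

namespace NewtonBody

/-! ### Graded families of subsets of a real vector space. -/

section GradedFamily

variable {E : Type*} [NormedAddCommGroup E] [NormedSpace ℝ E]

/-- A family of sets `P d ∋ 0` (`d ≥ 1`) with `P d + P e ⊆ P (d + e)` generating the group `L`. -/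
structure IsGradedFamily (P : ℕ → Set E) (L : AddSubgroup E) : Prop where
  zero_mem : ∀ d, 0 < d → (0 : E) ∈ P d
  add_mem : ∀ {d e x y}, x ∈ P d → y ∈ P e → x + y ∈ P (d + e)
  closure_eq : AddSubgroup.closure {x | ∃ d, 0 < d ∧ x ∈ P d} = L

/-- The points `x / d` with `x ∈ P d`. -/
def ratioSet (P : ℕ → Set E) : Set E := {u | ∃ d : ℕ, 0 < d ∧ (d : ℝ) • u ∈ P d}

namespace IsGradedFamily

variable {P : ℕ → Set E} {L : AddSubgroup E}

lemma mono (h : IsGradedFamily P L) {d e : ℕ} (hde : d ≤ e) {x : E} (hx : x ∈ P d) : x ∈ P e := by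
  rcases hde.eq_or_lt with rfl | hlt
  · exact hx
  · have := h.add_mem hx (h.zero_mem (e - d) (by omega))
    rwa [add_zero, Nat.add_sub_cancel' hde] at this

lemma zero_mem_ratioSet (h : IsGradedFamily P L) : (0 : E) ∈ ratioSet P :=
  ⟨1, one_pos, by simpa using h.zero_mem 1 one_pos⟩

lemma mem_group (h : IsGradedFamily P L) {d : ℕ} (hd : 0 < d) {x : E} (hx : x ∈ P d) : x ∈ L := by
  rw [← h.closure_eq]
  exact AddSubgroup.subset_closure ⟨d, hd, hx⟩

lemma nsmul_add_mem (h : IsGradedFamily P L) {d e : ℕ} {x y : E} (hx : x ∈ P d) (hy : y ∈ P e)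
    (l : ℕ) : l • x + y ∈ P (d * l + e) := by
  induction l with
  | zero => simpa using hy
  | succ l ih =>
    have := h.add_mem hx ih
    rw [succ_nsmul', add_assoc]
    convert this using 2
    ring

lemma nsmul_mem (h : IsGradedFamily P L) {d : ℕ} {x : E} (hx : x ∈ P d) {l : ℕ} (hl : 0 < l) :
    l • x ∈ P (d * l) := by
  obtain ⟨m, rfl⟩ : ∃ m, l = m + 1 := ⟨l - 1, by omega⟩
  have := h.nsmul_add_mem hx hx m
  rwa [← succ_nsmul, ← Nat.mul_succ] at this

lemma sum_nsmul_add_mem (h : IsGradedFamily P L) {ι : Type*} (s : Finset ι) (u : ι → E) (l : ι → ℕ)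
    {e D : ℕ} (hu : ∀ i ∈ s, u i ∈ P e) {w : E} (hw : w ∈ P D) :
    ∑ i ∈ s, l i • u i + w ∈ P (e * ∑ i ∈ s, l i + D) := by
  classical
  induction s using Finset.induction_on with
  | empty => simpa using hw
  | insert a s ha ih =>
    rw [Finset.sum_insert ha, Finset.sum_insert ha, add_assoc, mul_add, add_assoc]
    exact h.nsmul_add_mem (hu a (by simp)) (ih fun i hi => hu i (by simp [hi])) _

/-- Elements of the generated group are differences of two elements of one `P D`: sums add the two
representations, and negation exchanges the two terms. -/
lemma exists_add_mem (h : IsGradedFamily P L) {r : E} (hr : r ∈ L) :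
    ∃ D, 0 < D ∧ ∃ v ∈ P D, v + r ∈ P D := by
  rw [← h.closure_eq] at hr
  induction hr using AddSubgroup.closure_induction with
  | mem x hx =>
    obtain ⟨d, hd, hx⟩ := hx
    exact ⟨d, hd, 0, h.zero_mem d hd, by simpa using hx⟩
  | zero => exact ⟨1, one_pos, 0, h.zero_mem 1 one_pos, by simpa using h.zero_mem 1 one_pos⟩
  | add x y _ _ ihx ihy =>
    obtain ⟨D, hD, v, hv, hvx⟩ := ihx
    obtain ⟨D', hD', v', hv', hvx'⟩ := ihy
    refine ⟨D + D', by omega, v + v', h.add_mem hv hv', ?_⟩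
    rw [add_add_add_comm]
    exact h.add_mem hvx hvx'
  | neg x _ ih =>
    obtain ⟨D, hD, v, hv, hvx⟩ := ih
    exact ⟨D, hD, v + x, hvx, by simpa using hv⟩

lemma exists_forall_add_mem (h : IsGradedFamily P L) {R : Set E} (hR : R.Finite)
    (hRL : R ⊆ L) : ∃ D, 0 < D ∧ ∃ v ∈ P D, ∀ r ∈ R, v + r ∈ P D := by
  induction R, hR using Set.Finite.induction_on with
  | empty => exact ⟨1, one_pos, 0, h.zero_mem 1 one_pos, by simp⟩
  | insert _ _ ih =>
    rename_i a s _ _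
    obtain ⟨D, hD, v, hv, hvx⟩ := ih ((Set.subset_insert _ _).trans hRL)
    obtain ⟨D', hD', v', hv', hvx'⟩ := h.exists_add_mem (hRL (Set.mem_insert _ _))
    refine ⟨D + D', by omega, v + v', h.add_mem hv hv', ?_⟩
    rintro r (rfl | hr)
    · rw [add_assoc]
      exact h.add_mem hv hvx'
    · rw [add_right_comm]
      exact h.add_mem (hvx r hr) hv'

/-- Ratios do not change when element and degree are multiplied by the same integer, so the product
of the degrees serves for all of them. -/
lemma exists_common_degree (h : IsGradedFamily P L) (F : Finset E)
    (hF : (F : Set E) ⊆ ratioSet P) : ∃ e : ℕ, 0 < e ∧ ∀ u ∈ F, (e : ℝ) • u ∈ P e := by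
  classical
  induction F using Finset.induction_on with
  | empty => exact ⟨1, one_pos, by simp⟩
  | insert a s ha ih =>
    obtain ⟨e, he, hs⟩ := ih fun u hu => hF (by simp [Finset.mem_coe.1 hu])
    obtain ⟨d, hd, had⟩ := hF (a := a) (by simp)
    refine ⟨d * e, by positivity, fun u hu => ?_⟩
    rcases Finset.mem_insert.1 hu with rfl | hu
    · have := h.nsmul_mem had he
      rwa [← Nat.cast_smul_eq_nsmul ℝ, smul_smul, ← Nat.cast_mul, mul_comm e d] at this
    · have := h.nsmul_mem (hs u hu) hd
      rwa [← Nat.cast_smul_eq_nsmul ℝ, smul_smul, ← Nat.cast_mul, mul_comm e d] at this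

end IsGradedFamily

/-- The point is interior to a simplex inside the hull, and each vertex of the simplex needs only
finitely many points of `s`. -/
lemma exists_finset_mem_interior_convexHull [FiniteDimensional ℝ E] {s : Set E} {x : E}
    (hx : x ∈ interior (convexHull ℝ s)) :
    ∃ F : Finset E, (F : Set E) ⊆ s ∧ x ∈ interior (convexHull ℝ (F : Set E)) := by
  classical
  obtain ⟨b, hxb, hb⟩ := exists_mem_interior_convexHull_affineBasis (mem_interior_iff_mem_nhds.1 hx)
  have h1 : ∀ i, ∃ t : Finset E, (t : Set E) ⊆ s ∧ b i ∈ convexHull ℝ (t : Set E) := by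
    intro i
    have : b i ∈ convexHull ℝ s := hb (subset_convexHull ℝ _ ⟨i, rfl⟩)
    rw [convexHull_eq_union_convexHull_finite_subsets] at this
    simpa using this
  choose t hts ht using h1
  refine ⟨Finset.univ.biUnion t, by simpa using hts, interior_mono ?_ hxb⟩
  refine convexHull_min ?_ (convex_convexHull ℝ _)
  rintro _ ⟨i, rfl⟩
  exact convexHull_mono (by simpa using Set.subset_iUnion (fun i => (t i : Set E)) i) (ht i)

namespace IsGradedFamily

variable {P : ℕ → Set E} {L : AddSubgroup E}

/-- Near an interior point of the convex hull of the ratios, a graded family eventually contains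
all points of the group. -/
lemma exists_nhds_mem [FiniteDimensional ℝ E] (h : IsGradedFamily P L)
    (hL : ∀ R : ℝ, ((L : Set E) ∩ Metric.closedBall 0 R).Finite) {x : E}
    (hx : x ∈ interior (convexHull ℝ (ratioSet P))) :
    ∃ U ∈ 𝓝 x, ∀ᶠ d : ℕ in atTop, ∀ t ∈ L, (d : ℝ)⁻¹ • t ∈ U → t ∈ P d := by
  obtain ⟨F, hFP, hxF⟩ := exists_finset_mem_interior_convexHull hx
  obtain ⟨e, he, heF⟩ := h.exists_common_degree F hFP
  -- The radius bounds the error of rounding one coefficient down for each `u ∈ F`; `v` will absorb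
  -- every possible error.
  obtain ⟨D, hD, v, hv, hvR⟩ := h.exists_forall_add_mem
    (hL (∑ u ∈ F, ‖(e : ℝ) • u‖)) Set.inter_subset_left
  -- With `q = (d, t / d)` this is `(t - v) / (d - D)`: degree `D` is set aside for `v`, and the
  -- rest of `t` is to be written with ratios from `F`.
  have hlim : Tendsto (fun q : ℕ × E => ((q.1 : ℝ) / ((q.1 : ℝ) - D)) • q.2
      - ((q.1 : ℝ) - D)⁻¹ • v) (atTop ×ˢ 𝓝 x) (𝓝 x) := by
    have h0 : Tendsto (fun d : ℕ => ((d : ℝ) - D)) atTop atTop :=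
      tendsto_atTop_add_const_right _ _ tendsto_natCast_atTop_atTop
    have h1 : Tendsto (fun d : ℕ => ((d : ℝ) - D)⁻¹) atTop (𝓝 0) := h0.inv_tendsto_atTop
    have h2 : Tendsto (fun d : ℕ => (d : ℝ) / ((d : ℝ) - D)) atTop (𝓝 1) := by
      have : Tendsto (fun d : ℕ => 1 + D * ((d : ℝ) - D)⁻¹) atTop (𝓝 (1 + D * 0)) :=
        (h1.const_mul _).const_add _
      rw [mul_zero, add_zero] at this
      refine this.congr' ?_
      filter_upwards [h0.eventually_gt_atTop 0] with d hd
      field_simp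
      ring
    have := ((h2.comp tendsto_fst).smul tendsto_snd).sub
      ((h1.comp (tendsto_fst (f := (atTop : Filter ℕ)) (g := 𝓝 x))).smul_const v)
    simpa using this
  have hev := hlim.eventually (mem_interior_iff_mem_nhds.1 hxF)
  obtain ⟨pa, hpa, pb, hpb, hab⟩ := eventually_prod_iff.1 hev
  refine ⟨{z | pb z}, hpb, ?_⟩
  filter_upwards [hpa, eventually_gt_atTop D] with d hd hdD t ht htU
  have hdD' : (0 : ℝ) < (d : ℝ) - D := sub_pos.2 (by exact_mod_cast hdD)
  have hd0 : (0 : ℝ) < d := by exact_mod_cast (hD.trans hdD)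
  have hy := hab hd htU
  obtain ⟨w, hw0, hw1, hwy⟩ := Finset.mem_convexHull'.1 hy
  have he' : (0 : ℝ) < e := by exact_mod_cast he
  set c : E → ℝ := fun u => ((d : ℝ) - D) / e * w u with hc
  have hc0 : ∀ u ∈ F, 0 ≤ c u := fun u hu => mul_nonneg (by positivity) (hw0 u hu)
  have hsum : ∑ u ∈ F, c u • ((e : ℝ) • u) = t - v := by
    have : ∑ u ∈ F, c u • ((e : ℝ) • u) = ((d : ℝ) - D) • ∑ u ∈ F, w u • u := by
      rw [Finset.smul_sum]
      refine Finset.sum_congr rfl fun u _ => ?_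
      rw [smul_smul, smul_smul, hc]
      congr 1
      field_simp
    rw [this, hwy, smul_sub, smul_smul, smul_smul, smul_smul, mul_div_cancel₀ _ hdD'.ne',
      mul_inv_cancel₀ hd0.ne', mul_inv_cancel₀ hdD'.ne', one_smul, one_smul]
  -- The rounding error. It is a group element of bounded norm, so `v + r ∈ P D`.
  set r : E := t - v - ∑ u ∈ F, ⌊c u⌋₊ • ((e : ℝ) • u) with hr
  have hrL : r ∈ L := L.sub_mem (L.sub_mem ht (h.mem_group hD hv))
    (L.sum_mem fun u hu => L.nsmul_mem (h.mem_group he (heF u hu)) _)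
  have hrn : r ∈ Metric.closedBall (0 : E) (∑ u ∈ F, ‖(e : ℝ) • u‖) := by
    rw [mem_closedBall_zero_iff, hr, ← hsum, ← Finset.sum_sub_distrib]
    refine norm_sum_le_of_le _ fun u hu => ?_
    rw [← Nat.cast_smul_eq_nsmul ℝ, ← sub_smul, norm_smul]
    refine mul_le_of_le_one_left (norm_nonneg _) ?_
    rw [Real.norm_eq_abs, abs_le]
    have h1 := Nat.floor_le (hc0 u hu)
    have h2 := Nat.lt_floor_add_one (c u)
    constructor <;> linarith
  have hfin := h.sum_nsmul_add_mem F (fun u => (e : ℝ) • u) (fun u => ⌊c u⌋₊) heF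
    (hvR r ⟨hrL, hrn⟩)
  have ht' : ∑ u ∈ F, ⌊c u⌋₊ • ((e : ℝ) • u) + (v + r) = t := by
    rw [hr]; abel
  rw [ht'] at hfin
  refine h.mono ?_ hfin
  -- The unrounded coefficients use degree exactly `e ∑ c u = d - D`.
  have : ((e * ∑ u ∈ F, ⌊c u⌋₊ + D : ℕ) : ℝ) ≤ d := by
    push_cast
    have h1 : ∑ u ∈ F, (⌊c u⌋₊ : ℝ) ≤ ∑ u ∈ F, c u :=
      Finset.sum_le_sum fun u hu => Nat.floor_le (hc0 u hu)
    have h2 : ∑ u ∈ F, c u = ((d : ℝ) - D) / e := by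
      rw [hc, ← Finset.mul_sum, hw1, mul_one]
    have h3 : (e : ℝ) * ∑ u ∈ F, (⌊c u⌋₊ : ℝ) ≤ e * (((d : ℝ) - D) / e) := by
      rw [← h2]
      gcongr
    rw [mul_div_cancel₀ _ he'.ne'] at h3
    linarith
  exact_mod_cast this

lemma eventually_mem_of_isCompact [FiniteDimensional ℝ E] (h : IsGradedFamily P L)
    (hL : ∀ R : ℝ, ((L : Set E) ∩ Metric.closedBall 0 R).Finite) {K : Set E} (hK : IsCompact K)
    (hKP : K ⊆ interior (convexHull ℝ (ratioSet P))) :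
    ∀ᶠ d : ℕ in atTop, ∀ t ∈ L, (d : ℝ)⁻¹ • t ∈ K → t ∈ P d := by
  refine hK.induction_on (p := fun K => ∀ᶠ d : ℕ in atTop, ∀ t ∈ L, (d : ℝ)⁻¹ • t ∈ K → t ∈ P d)
    ?_ ?_ ?_ ?_
  · simp
  · intro s t hst ht
    filter_upwards [ht] with d hd x hx hxs using hd x hx (hst hxs)
  · intro s t hs ht
    filter_upwards [hs, ht] with d hd hd' x hx hxs
    exact hxs.elim (hd x hx) (hd' x hx)
  · intro x hx
    obtain ⟨U, hU, hd⟩ := h.exists_nhds_mem hL (hKP hx)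
    exact ⟨U, mem_nhdsWithin_of_mem_nhds hU, hd⟩

end IsGradedFamily

end GradedFamily

end NewtonBody

namespace NewtonBody

/-! ### Volume and boundedness of convex sets. -/

section ConvexVolume

variable {E : Type*} [NormedAddCommGroup E] [NormedSpace ℝ E] [FiniteDimensional ℝ E]
  [MeasurableSpace E] [BorelSpace E]

/-- A convex set with interior points containing no convex compact sets of large volume is
bounded. -/
lemma isBounded_of_measureReal_le (μ : Measure E) [μ.IsAddHaarMeasure] {s : Set E}
    (hs : Convex ℝ s) (hne : (interior s).Nonempty) (q : ℝ)
    (hq : ∀ K ⊆ interior s, IsCompact K → Convex ℝ K → μ.real K ≤ q) :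
    Bornology.IsBounded s := by
  obtain ⟨c, hc⟩ := hne
  obtain ⟨ρ, hρ, hball⟩ := Metric.nhds_basis_closedBall.mem_iff.1
    (isOpen_interior.mem_nhds hc)
  set r := ρ / 2 with hr
  have hr0 : 0 < r := by positivity
  have hm : 0 < μ.real (Metric.closedBall (0 : E) r) :=
    ENNReal.toReal_pos (Metric.measure_closedBall_pos μ _ hr0).ne' measure_closedBall_lt_top.ne
  obtain ⟨N, hN⟩ := exists_nat_gt (q / μ.real (Metric.closedBall (0 : E) r))
  rw [div_lt_iff₀ hm] at hN
  by_contra hunb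
  have hfar : ∃ x ∈ s, 2 * N * (2 * r) < ‖x - c‖ := by
    by_contra! hcon
    refine hunb ((Metric.isBounded_closedBall (x := c) (r := 2 * N * (2 * r))).subset fun x hx => ?_)
    rw [mem_closedBall_iff_norm]
    exact hcon x hx
  obtain ⟨x, hx, hxc⟩ := hfar
  -- Only the half of the segment near `c` is used: there the convex hull of `x` and the ball of
  -- radius `ρ` around `c` still has thickness at least `ρ / 2 = r`.
  set m : E := c + (1 / 2 : ℝ) • (x - c) with hmid
  set K : Set E := segment ℝ c m + Metric.closedBall 0 r with hK
  have hKc : IsCompact K := by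
    refine IsCompact.add ?_ (isCompact_closedBall _ _)
    rw [← convexHull_pair]
    exact (Set.toFinite _).isCompact_convexHull ℝ
  have hKs : K ⊆ interior s := by
    rintro _ ⟨y, hy, z, hz, rfl⟩
    rw [segment_eq_image'] at hy
    obtain ⟨θ, ⟨hθ0, hθ1⟩, rfl⟩ := hy
    have h1 : (0 : ℝ) < 1 - θ / 2 := by linarith
    have hz' : c + (1 - θ / 2)⁻¹ • z ∈ interior s := by
      refine hball ?_
      rw [mem_closedBall_iff_norm, add_sub_cancel_left, norm_smul, norm_inv, Real.norm_eq_abs,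
        abs_of_pos h1, inv_mul_le_iff₀ h1]
      rw [mem_closedBall_zero_iff] at hz
      nlinarith
    have := hs.combo_interior_self_mem_interior hz' hx h1 (b := θ / 2) (by linarith) (by ring)
    convert this using 1
    rw [smul_add, smul_smul, mul_inv_cancel₀ h1.ne', hmid]
    simp only
    module
  have hle := hq K hKs hKc ((convex_segment _ _).add (convex_closedBall _ _))
  -- Consecutive centres are `‖x - c‖ / (2N) > 2r` apart, so these are `N` disjoint balls in `K`,
  -- with total volume above `q`.
  set f : ℕ → Set E := fun i => Metric.closedBall (c + ((i : ℝ) / (2 * N)) • (x - c)) r with hf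
  have hfK : (⋃ i ∈ Finset.range N, f i) ⊆ K := by
    intro y hy
    simp only [Set.mem_iUnion, Finset.mem_range] at hy
    obtain ⟨i, hi, hy⟩ := hy
    have hN0 : (0 : ℝ) < N := by exact_mod_cast (Nat.zero_le _).trans_lt hi
    refine ⟨c + ((i : ℝ) / (2 * N)) • (x - c), ?_, y - (c + ((i : ℝ) / (2 * N)) • (x - c)), ?_,
      add_sub_cancel _ _⟩
    · rw [segment_eq_image']
      refine ⟨(i : ℝ) / N, ⟨by positivity, ?_⟩, ?_⟩
      · rw [div_le_one hN0]
        exact_mod_cast hi.le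
      · simp only [hmid, add_sub_cancel_left, smul_smul]
        congr 2
        field_simp
    · rw [mem_closedBall_zero_iff, ← mem_closedBall_iff_norm]
      exact hy
  have hdisj : Set.PairwiseDisjoint (Finset.range N : Set ℕ) f := by
    intro i hi j hj hij
    refine Metric.closedBall_disjoint_closedBall ?_
    have hi' : i < N := by simpa using hi
    have hN0 : (0 : ℝ) < N := by exact_mod_cast (Nat.zero_le _).trans_lt hi'
    rw [dist_eq_norm, add_sub_add_left_eq_sub, ← sub_smul, ← sub_div, norm_smul, norm_div,
      Real.norm_of_nonneg (by positivity : (0 : ℝ) ≤ 2 * N)]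
    have h1 : (1 : ℝ) ≤ ‖(i : ℝ) - j‖ := by
      have : (1 : ℤ) ≤ |(i : ℤ) - j| := Int.one_le_abs (by omega)
      rw [Real.norm_eq_abs]
      exact_mod_cast this
    rw [div_mul_eq_mul_div, lt_div_iff₀ (by positivity)]
    nlinarith [norm_nonneg (x - c)]
  have hvol : μ.real (⋃ i ∈ Finset.range N, f i) = N * μ.real (Metric.closedBall (0 : E) r) := by
    rw [measureReal_biUnion_finset hdisj (fun _ _ => Metric.isClosed_closedBall.measurableSet)
      (fun _ _ => measure_closedBall_lt_top.ne)]
    simp [hf, measureReal_def, Measure.addHaar_closedBall_center]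
  have := measureReal_mono hfK hKc.measure_lt_top.ne (μ := μ)
  linarith

end ConvexVolume

/-- Finitely many interiors of simplices contained in `U` cover `K`; their vertices form `F`. -/
lemma exists_finite_convexHull_between {E : Type*} [NormedAddCommGroup E] [NormedSpace ℝ E]
    [FiniteDimensional ℝ E] {K U : Set E} (hK : IsCompact K) (hU : IsOpen U) (hKU : K ⊆ U) :
    ∃ F : Set E, F.Finite ∧ F ⊆ U ∧ K ⊆ convexHull ℝ F := by
  refine hK.induction_on (p := fun K => ∃ F : Set E, F.Finite ∧ F ⊆ U ∧ K ⊆ convexHull ℝ F)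
    ⟨∅, by simp⟩ ?_ ?_ ?_
  · rintro s t hst ⟨F, hF, hFU, ht⟩
    exact ⟨F, hF, hFU, hst.trans ht⟩
  · rintro s t ⟨F, hF, hFU, hs⟩ ⟨F', hF', hFU', ht⟩
    exact ⟨F ∪ F', hF.union hF', Set.union_subset hFU hFU', Set.union_subset
      (hs.trans (convexHull_mono Set.subset_union_left))
      (ht.trans (convexHull_mono Set.subset_union_right))⟩
  · intro x hx
    obtain ⟨b, hxb, hb⟩ := exists_mem_interior_convexHull_affineBasis (hU.mem_nhds (hKU hx))
    exact ⟨interior (convexHull ℝ (Set.range b)),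
      mem_nhdsWithin_of_mem_nhds (isOpen_interior.mem_nhds hxb), Set.range b,
      Set.finite_range _, (subset_convexHull ℝ _).trans hb, interior_subset⟩

/-! ### Counting the points of a graded family in a lattice. -/

section Counting

variable {k : ℕ} {P : ℕ → Set (Fin k → ℝ)} {L : Submodule ℤ (Fin k → ℝ)} [DiscreteTopology L]
  [IsZLattice ℝ L]

lemma finite_lattice_inter {s : Set (Fin k → ℝ)} (hs : Bornology.IsBounded s) :
    ((L : Set (Fin k → ℝ)) ∩ s).Finite := by
  rw [Set.inter_comm]
  refine Metric.finite_isBounded_inter_isClosed DiscreteTopology.isDiscrete hs ?_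
  exact inferInstanceAs (IsClosed (L.toAddSubgroup : Set (Fin k → ℝ)))

lemma finite_lattice_smul {s : Set (Fin k → ℝ)} (hs : Bornology.IsBounded s) {d : ℕ} (hd : 0 < d) :
    {t | t ∈ L ∧ (d : ℝ)⁻¹ • t ∈ s}.Finite := by
  refine (finite_lattice_inter (L := L) (hs.smul₀ (d : ℝ))).subset ?_
  rintro t ⟨ht, hts⟩
  exact ⟨ht, (d : ℝ)⁻¹ • t, hts, smul_inv_smul₀ (by positivity) _⟩

lemma tendsto_ncard_lattice_div {s : Set (Fin k → ℝ)} (hs : Bornology.IsBounded s)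
    (hc : Convex ℝ s) (hm : MeasurableSet s) :
    Tendsto (fun d : ℕ => ({t | t ∈ L ∧ (d : ℝ)⁻¹ • t ∈ s}.ncard : ℝ) / (d : ℝ) ^ k) atTop
      (𝓝 (volume.real s / ZLattice.covolume L)) := by
  have := ZLattice.covolume.tendsto_card_div_pow L (IsZLattice.basis L) hs hm
    (hc.addHaar_frontier volume)
  rw [Fintype.card_fin] at this
  refine this.congr' ?_
  filter_upwards [eventually_gt_atTop 0] with d hd
  have hd' : (d : ℝ) ≠ 0 := by positivity
  congr 2
  rw [Nat.card_coe_set_eq, ← Set.ncard_image_of_injective _ (smul_right_injective _ hd')]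
  congr 1
  ext t
  constructor
  · rintro ⟨x, ⟨hx, y, hy, rfl⟩, rfl⟩
    simp only [smul_inv_smul₀ hd']
    exact ⟨hy, hx⟩
  · rintro ⟨ht, hts⟩
    exact ⟨(d : ℝ)⁻¹ • t, ⟨hts, t, ht, rfl⟩, smul_inv_smul₀ hd' _⟩

namespace IsGradedFamily

lemma span_ratioSet (h : IsGradedFamily P L.toAddSubgroup) :
    Submodule.span ℝ (ratioSet P) = ⊤ := by
  rw [eq_top_iff, ← IsZLattice.span_top (K := ℝ) (L := L), Submodule.span_le]
  intro x hx
  change x ∈ L.toAddSubgroup at hx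
  have hle : L.toAddSubgroup ≤ (Submodule.span ℝ (ratioSet P)).toAddSubgroup := by
    rw [← h.closure_eq, AddSubgroup.closure_le]
    rintro y ⟨d, hd, hy⟩
    have hd' : (d : ℝ) ≠ 0 := by positivity
    have : (d : ℝ)⁻¹ • y ∈ ratioSet P := ⟨d, hd, by rwa [smul_inv_smul₀ hd']⟩
    have := Submodule.smul_mem _ (d : ℝ) (Submodule.subset_span (R := ℝ) this)
    rwa [smul_inv_smul₀ hd'] at this
  exact hle hx

lemma interior_convexHull_nonempty (h : IsGradedFamily P L.toAddSubgroup) :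
    (interior (convexHull ℝ (ratioSet P))).Nonempty := by
  rw [(convex_convexHull ℝ _).interior_nonempty_iff_affineSpan_eq_top, affineSpan_convexHull,
    AffineSubspace.affineSpan_eq_top_iff_vectorSpan_eq_top_of_nonempty ℝ _ _ ⟨0, h.zero_mem_ratioSet⟩,
    vectorSpan_eq_span_vsub_set_right ℝ h.zero_mem_ratioSet]
  simpa using h.span_ratioSet

/-- The points of a graded family eventually fill convex compact sets of interior points. -/
lemma eventually_ncard_le (h : IsGradedFamily P L.toAddSubgroup) (hfin : ∀ d, 0 < d → (P d).Finite)
    {K : Set (Fin k → ℝ)} (hK : IsCompact K) (hKP : K ⊆ interior (convexHull ℝ (ratioSet P))) :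
    ∀ᶠ d : ℕ in atTop, {t | t ∈ L ∧ (d : ℝ)⁻¹ • t ∈ K}.ncard ≤ (P d).ncard := by
  filter_upwards [h.eventually_mem_of_isCompact
    (fun R => finite_lattice_inter Metric.isBounded_closedBall) hK hKP, eventually_gt_atTop 0]
    with d hd hd0
  exact Set.ncard_le_ncard (fun t ht => hd t ht.1 ht.2) (hfin d hd0)

/-- For convex compact `K` inside the hull, `P d` eventually contains the lattice points of `d K`,
about `vol K / covol L · dᵏ` of them. The growth bound therefore gives `vol K ≤ q · covol L`. -/
lemma isBounded_ratioSet (h : IsGradedFamily P L.toAddSubgroup)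
    (hfin : ∀ d, 0 < d → (P d).Finite) {q : ℝ}
    (hq : ∀ d : ℕ, 0 < d → ((P d).ncard : ℝ) ≤ q * (d : ℝ) ^ k) :
    Bornology.IsBounded (ratioSet P) := by
  refine (isBounded_of_measureReal_le volume (convex_convexHull ℝ _)
    h.interior_convexHull_nonempty (q * ZLattice.covolume L) fun K hKP hK hKc => ?_).subset
    (subset_convexHull ℝ _)
  rw [← div_le_iff₀ (ZLattice.covolume_pos L volume)]
  refine le_of_tendsto (tendsto_ncard_lattice_div (L := L) hK.isBounded hKc hK.measurableSet) ?_
  filter_upwards [h.eventually_ncard_le hfin hK hKP, eventually_gt_atTop 0] with d hd hd0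
  rw [div_le_iff₀ (by positivity)]
  exact le_trans (by exact_mod_cast hd) (hq d hd0)

lemma finite_of_isBounded (h : IsGradedFamily P L.toAddSubgroup)
    (hb : Bornology.IsBounded (ratioSet P)) {d : ℕ} (hd : 0 < d) : (P d).Finite := by
  refine (finite_lattice_smul (L := L) hb hd).subset fun t ht => ⟨h.mem_group hd ht, d, hd, ?_⟩
  rwa [smul_inv_smul₀ (by positivity)]

/-- The number of points of a graded family grows like the volume of the convex body of ratios. -/
lemma tendsto_ncard_div (h : IsGradedFamily P L.toAddSubgroup)
    (hb : Bornology.IsBounded (ratioSet P)) :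
    Tendsto (fun d : ℕ => ((P d).ncard : ℝ) / (d : ℝ) ^ k) atTop
      (𝓝 (volume.real (closure (convexHull ℝ (ratioSet P))) / ZLattice.covolume L)) := by
  have hcov := ZLattice.covolume_pos L volume
  have hconv : Convex ℝ (convexHull ℝ (ratioSet P)) := convex_convexHull ℝ _
  have hbX : Bornology.IsBounded (closure (convexHull ℝ (ratioSet P))) :=
    ((isBounded_convexHull).2 hb).closure
  have hfin : ∀ d, 0 < d → (P d).Finite := fun d hd => h.finite_of_isBounded hb hd
  refine tendsto_order.2 ⟨fun a ha => ?_, fun a ha => ?_⟩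
  -- Negative `a` is separated because the inner approximation below compares `a` with measures
  -- valued in `ENNReal`.
  · rcases lt_or_ge a 0 with ha0 | ha0
    · exact Eventually.of_forall fun d => ha0.trans_le (by positivity)
    · have hint : volume (closure (convexHull ℝ (ratioSet P)))
          = volume (interior (convexHull ℝ (ratioSet P))) :=
        measure_congr ((interior_ae_eq_of_null_frontier (hconv.addHaar_frontier volume)).trans
          (closure_ae_eq_of_null_frontier (hconv.addHaar_frontier volume)).symm).symm
      rw [lt_div_iff₀ hcov, measureReal_def, hint] at ha
      have ha' := (ENNReal.ofReal_lt_iff_lt_toReal (by positivity)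
        ((measure_mono interior_subset_closure).trans_lt hbX.measure_lt_top).ne).2 ha
      obtain ⟨K, hKs, hK, hKa⟩ := isOpen_interior.exists_lt_isCompact ha'
      -- Inner regularity gives an arbitrary compact set; a polytope around it is convex, so lattice
      -- points in its dilates can be counted.
      obtain ⟨F, hF, hFI, hKF⟩ := exists_finite_convexHull_between hK isOpen_interior hKs
      have hK' := hF.isCompact_convexHull ℝ
      have hKP' : convexHull ℝ F ⊆ interior (convexHull ℝ (ratioSet P)) :=
        convexHull_min hFI hconv.interior
      have hlt : a < volume.real (convexHull ℝ F) / ZLattice.covolume L := by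
        rw [lt_div_iff₀ hcov]
        exact (ENNReal.ofReal_lt_iff_lt_toReal (by positivity) hK'.measure_lt_top.ne).1
          (hKa.trans_le (measure_mono hKF))
      have hev := (tendsto_ncard_lattice_div (L := L) hK'.isBounded (convex_convexHull ℝ _)
        hK'.measurableSet).eventually_const_lt hlt
      filter_upwards [hev, h.eventually_ncard_le hfin hK' hKP'] with d hd hd'
      refine hd.trans_le ?_
      gcongr
  · have hev := (tendsto_ncard_lattice_div (L := L) hbX hconv.closure
      isClosed_closure.measurableSet).eventually_lt_const ha
    filter_upwards [hev, eventually_gt_atTop 0] with d hd hd0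
    refine lt_of_le_of_lt ?_ hd
    gcongr
    · exact finite_lattice_smul hbX hd0
    · intro t ht
      refine ⟨h.mem_group hd0 ht, subset_closure (subset_convexHull ℝ _ ⟨d, hd0, ?_⟩)⟩
      rwa [smul_inv_smul₀ (by positivity)]

end IsGradedFamily

end Counting

end NewtonBody

namespace NewtonBody

section RealVec

variable {n : ℕ}

@[simp] lemma realVec_apply (m : Fin n → ℤ) (i : Fin n) : realVec m i = (m i : ℝ) := rfl

/-- The inclusion `ℤⁿ ⊂ ℝⁿ` as a homomorphism. -/
noncomputable def realVecHom (n : ℕ) : (Fin n → ℤ) →+ EuclideanSpace ℝ (Fin n) where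
  toFun := realVec
  map_zero' := by ext i; simp
  map_add' x y := by ext i; simp

lemma realVec_add (x y : Fin n → ℤ) : realVec (x + y) = realVec x + realVec y :=
  map_add (realVecHom n) x y

lemma realVec_sub (x y : Fin n → ℤ) : realVec (x - y) = realVec x - realVec y :=
  map_sub (realVecHom n) x y

lemma realVec_zsmul (l : ℤ) (x : Fin n → ℤ) : realVec (l • x) = (l : ℝ) • realVec x := by
  ext i; simp

lemma realVec_nsmul (l : ℕ) (x : Fin n → ℤ) : realVec (l • x) = (l : ℝ) • realVec x := by
  ext i; simp

end RealVec

/-! ### Coordinates on a subgroup of `ℤⁿ` and the covolume of its sublattices. -/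

section Coordinates

variable {n k : ℕ} {M : AddSubgroup (Fin n → ℤ)} (b : Module.Basis (Fin k) ℤ M)

/-- The real coordinates of a lattice element in a basis. -/
noncomputable def coordHom : M →+ (Fin k → ℝ) where
  toFun m i := (b.repr m i : ℝ)
  map_zero' := by ext i; simp
  map_add' x y := by ext i; simp

lemma coordHom_apply (m : M) (i : Fin k) : coordHom b m i = (b.repr m i : ℝ) := rfl

lemma coordHom_injective : Function.Injective (coordHom b) := fun x y h => by
  refine b.ext_elem fun i => ?_
  have := congrFun h i
  simpa [coordHom_apply] using this

/-- The linear parametrisation of the real span of a lattice given by a basis. -/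
noncomputable def paramMap : (Fin k → ℝ) →ₗ[ℝ] EuclideanSpace ℝ (Fin n) :=
  Fintype.linearCombination ℝ fun i => realVec (b i : Fin n → ℤ)

lemma paramMap_apply (c : Fin k → ℝ) :
    paramMap b c = ∑ i, c i • realVec (b i : Fin n → ℤ) := rfl

lemma paramMap_coordHom (m : M) : paramMap b (coordHom b m) = realVec (m : Fin n → ℤ) := by
  conv_rhs => rw [← b.sum_repr m]
  rw [paramMap_apply, AddSubgroup.val_finsetSum]
  change _ = realVecHom n _
  rw [map_sum]
  refine Finset.sum_congr rfl fun i _ => ?_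
  change _ = realVec _
  rw [AddSubgroup.coe_zsmul, realVec_zsmul, coordHom_apply]

/-- Integer vectors independent over `ℤ` remain independent over `ℝ`. -/
lemma paramMap_injective : Function.Injective (paramMap b) := by
  have h1 : LinearIndependent ℤ fun i => (b i : Fin n → ℤ) :=
    b.linearIndependent.map' M.subtype.toIntLinearMap
      (LinearMap.ker_eq_bot.2 M.subtype_injective)
  have h2 := (linearIndependent_algebraMap_comp_iff (R := ℤ) (S := ℝ)).2 h1
  have h3 : LinearIndependent ℝ fun i => realVec (b i : Fin n → ℤ) :=
    h2.map' (WithLp.linearEquiv 2 ℝ (Fin n → ℝ)).symm.toLinearMap (LinearEquiv.ker _)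
  exact h3.fintypeLinearCombination_injective

lemma paramMap_isClosedEmbedding : IsClosedEmbedding (paramMap b) :=
  LinearMap.isClosedEmbedding_of_injective (LinearMap.ker_eq_bot.2 (paramMap_injective b))

/-- The coordinates of the elements of a group `T`. -/
noncomputable def coordLattice (T : AddSubgroup (Fin n → ℤ)) : Submodule ℤ (Fin k → ℝ) :=
  AddSubgroup.toIntSubmodule ((T.addSubgroupOf M).map (coordHom b))

lemma mem_coordLattice {T : AddSubgroup (Fin n → ℤ)} {c : Fin k → ℝ} :
    c ∈ coordLattice b T ↔ ∃ m : M, (m : Fin n → ℤ) ∈ T ∧ coordHom b m = c := Iff.rfl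

lemma coordLattice_self :
    coordLattice b M = Submodule.span ℤ (Set.range (Pi.basisFun ℝ (Fin k))) := by
  ext c
  rw [mem_coordLattice, Module.Basis.mem_span_iff_repr_mem]
  constructor
  · rintro ⟨m, _, rfl⟩ i
    exact ⟨b.repr m i, by simp [coordHom_apply]⟩
  · intro h
    choose z hz using h
    refine ⟨b.equivFun.symm z, SetLike.coe_mem _, ?_⟩
    ext i
    have := hz i
    simp only [Pi.basisFun_repr] at this
    rw [coordHom_apply, ← this, ← b.equivFun_apply, LinearEquiv.apply_symm_apply]
    rfl

lemma coordLattice_le (T : AddSubgroup (Fin n → ℤ)) : coordLattice b T ≤ coordLattice b M := by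
  rintro _ ⟨m, _, rfl⟩
  exact ⟨m, m.2, rfl⟩

instance discreteTopology_coordLattice (T : AddSubgroup (Fin n → ℤ)) :
    DiscreteTopology (coordLattice b T) := by
  have h : coordLattice b T ≤ Submodule.span ℤ (Set.range (Pi.basisFun ℝ (Fin k))) :=
    (coordLattice_le b T).trans (coordLattice_self b).le
  exact DiscreteTopology.of_subset (ZSpan.discreteTopology_pi_basisFun (ι := Fin k)) h

lemma isZLattice_coordLattice {T : AddSubgroup (Fin n → ℤ)}
    (hT : ∀ m ∈ M, ∃ l : ℕ, 0 < l ∧ l • m ∈ T) : IsZLattice ℝ (coordLattice b T) := by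
  refine ⟨?_⟩
  rw [eq_top_iff, ← (Pi.basisFun ℝ (Fin k)).span_eq, Submodule.span_le]
  rintro _ ⟨i, rfl⟩
  obtain ⟨l, hl, hlT⟩ := hT (b i) (SetLike.coe_mem _)
  have hl' : (l : ℝ) ≠ 0 := by positivity
  have hmem : coordHom b (l • b i) ∈ coordLattice b T := ⟨l • b i, hlT, rfl⟩
  have : (Pi.basisFun ℝ (Fin k)) i = (l : ℝ)⁻¹ • coordHom b (l • b i) := by
    rw [map_nsmul, ← Nat.cast_smul_eq_nsmul ℝ, inv_smul_smul₀ hl']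
    ext j
    simp [coordHom_apply, Finsupp.single_apply, Pi.single_apply, eq_comm]
  rw [this]
  exact Submodule.smul_mem _ _ (Submodule.subset_span hmem)

/-- In its own basis `M` is the standard lattice, of covolume 1, and a sublattice multiplies the
covolume by its index. -/
lemma covolume_coordLattice {T : AddSubgroup (Fin n → ℤ)}
    (hT : ∀ m ∈ M, ∃ l : ℕ, 0 < l ∧ l • m ∈ T) :
    ZLattice.covolume (coordLattice b T) = T.relIndex M := by
  have := isZLattice_coordLattice b hT
  have hM := isZLattice_coordLattice b (T := M) fun m hm => ⟨1, one_pos, by simpa⟩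
  have h1 : ZLattice.covolume (coordLattice b M) = 1 := by
    rw [ZLattice.covolume_eq_measure_fundamentalDomain (coordLattice b M) volume
      (F := ZSpan.fundamentalDomain (Pi.basisFun ℝ (Fin k)))
      (coordLattice_self b ▸ ZSpan.isAddFundamentalDomain (Pi.basisFun ℝ (Fin k)) volume),
      ZSpan.volume_real_fundamentalDomain]
    have : Matrix.of (⇑(Pi.basisFun ℝ (Fin k))) = 1 := by
      ext i j
      simp [Matrix.one_apply, Pi.single_apply, eq_comm]
    rw [this, Matrix.det_one, abs_one]
  have h2 := ZLattice.covolume_div_covolume_eq_relIndex _ _ (coordLattice_le b T)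
  rw [h1, div_one] at h2
  rw [h2]
  have h3 : (coordLattice b M).toAddSubgroup = (⊤ : AddSubgroup M).map (coordHom b) := by
    ext c
    constructor
    · rintro ⟨m, _, rfl⟩; exact ⟨m, trivial, rfl⟩
    · rintro ⟨m, _, rfl⟩; exact ⟨m, m.2, rfl⟩
  have h4 : (coordLattice b T).toAddSubgroup = (T.addSubgroupOf M).map (coordHom b) := rfl
  rw [h3, h4, AddSubgroup.relIndex_map_map_of_injective _ _ (coordHom_injective b),
    AddSubgroup.relIndex_top_right]
  rfl

end Coordinates

/-! ### The saturation of a subgroup of `ℤⁿ`. -/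

section Saturation

variable {n : ℕ}

lemma le_saturation (T : AddSubgroup (Fin n → ℤ)) : T ≤ saturation T :=
  fun m hm => ⟨1, one_pos, by simpa⟩

/-- The quotient is a finitely generated torsion abelian group, hence finite. -/
lemma relIndex_saturation_ne_zero (T : AddSubgroup (Fin n → ℤ)) :
    T.relIndex (saturation T) ≠ 0 := by
  have hfg : AddGroup.FG (saturation T) := by
    have : Module.Finite ℤ (AddSubgroup.toIntSubmodule (saturation T)) := inferInstance
    exact Module.Finite.iff_addGroup_fg.1 this
  have htors : IsAddTorsion (saturation T ⧸ T.addSubgroupOf (saturation T)) := by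
    intro x
    obtain ⟨m, rfl⟩ := QuotientAddGroup.mk_surjective x
    obtain ⟨l, hl, hlT⟩ := m.2
    refine isOfFinAddOrder_iff_nsmul_eq_zero.2 ⟨l, hl, ?_⟩
    rw [← QuotientAddGroup.mk_nsmul, QuotientAddGroup.eq_zero_iff]
    exact hlT
  have := AddCommGroup.finite_of_fg_isAddTorsion _ htors
  exact AddSubgroup.index_ne_zero_of_finite

/-- In the coordinates of `b`, `T` is a full lattice in `ℝᵏ`. -/
lemma finrank_eq_of_basis_saturation (T : AddSubgroup (Fin n → ℤ)) {k : ℕ}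
    (b : Module.Basis (Fin k) ℤ (saturation T)) : Module.finrank ℤ T = k := by
  have hT : ∀ m ∈ saturation T, ∃ l : ℕ, 0 < l ∧ l • m ∈ T := fun m hm => hm
  have := isZLattice_coordLattice b hT
  have h1 := ZLattice.rank ℝ (coordLattice b T)
  rw [Module.finrank_fin_fun] at h1
  let e : T ≃+ coordLattice b T :=
    (AddSubgroup.addSubgroupOfEquivOfLe (le_saturation T)).symm.trans
      (AddSubgroup.equivMapOfInjective _ _ (coordHom_injective b))
  exact e.toIntLinearEquiv.finrank_eq.trans h1

lemma nonempty_basis_saturation (T : AddSubgroup (Fin n → ℤ)) {k : ℕ}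
    (hk : Module.finrank ℤ T = k) : Nonempty (Module.Basis (Fin k) ℤ (saturation T)) := by
  have hfin : Module.Finite ℤ (saturation T) :=
    inferInstanceAs (Module.Finite ℤ (AddSubgroup.toIntSubmodule (saturation T)))
  have hfree : Module.Free ℤ (saturation T) :=
    inferInstanceAs (Module.Free ℤ (AddSubgroup.toIntSubmodule (saturation T)))
  let b := Module.finBasis ℤ (saturation T)
  have := finrank_eq_of_basis_saturation T b
  exact ⟨Module.finBasisOfFinrankEq ℤ _ (by omega)⟩

end Saturation

/-! ### From a graded semigroup to a graded family. -/

section Family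

variable {n k : ℕ}

lemma sub_smul_mem_groupT {G : AddSubsemigroup (IntPts n)} {A : IntPts n} (hA : A ∈ genGroup G)
    (hA1 : A.1 = 1) {p : IntPts n} (hp : p ∈ genGroup G) : p.2 - p.1 • A.2 ∈ groupT G := by
  have h := (genGroup G).sub_mem hp ((genGroup G).zsmul_mem hA p.1)
  have h2 : p - p.1 • A = (0, p.2 - p.1 • A.2) := by
    ext i <;> simp [hA1]
  rw [h2] at h
  exact h

lemma mem_genGroup {G : AddSubsemigroup (IntPts n)} {p : IntPts n} (hp : p ∈ G) :
    p ∈ genGroup G := AddSubgroup.subset_closure hp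

variable {G : AddSubsemigroup (IntPts n)} (b : Module.Basis (Fin k) ℤ (groupM G)) (A : IntPts n)

/-- The elements of degree `d`, translated by `-d A` and expressed in coordinates. -/
def coordFamily (d : ℕ) : Set (Fin k → ℝ) :=
  {c | ∃ m : groupM G, ((d : ℤ), d • A.2 + (m : Fin n → ℤ)) ∈ G ∧ coordHom b m = c}

variable {A}

lemma isGradedFamily_coordFamily (hG : IsGraded G) (hA : A ∈ G) (hA1 : A.1 = 1) :
    IsGradedFamily (coordFamily b A) (coordLattice b (groupT G)).toAddSubgroup where
  zero_mem d hd := by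
    refine ⟨0, ?_, map_zero _⟩
    have h : ∀ d : ℕ, 0 < d → d • A ∈ G := by
      intro d hd
      induction d, hd using Nat.le_induction with
      | base => simpa using hA
      | succ d _ ih => rw [succ_nsmul]; exact G.add_mem ih hA
    convert h d hd using 1
    ext i <;> simp [hA1]
  add_mem := by
    rintro d e _ _ ⟨m, hm, rfl⟩ ⟨m', hm', rfl⟩
    refine ⟨m + m', ?_, map_add _ _ _⟩
    convert G.add_mem hm hm' using 1
    ext i
    · simp
    · simp; ring
  closure_eq := by
    refine le_antisymm ?_ ?_
    · rw [AddSubgroup.closure_le]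
      rintro _ ⟨d, hd, m, hm, rfl⟩
      refine ⟨m, ?_, rfl⟩
      have := sub_smul_mem_groupT (mem_genGroup hA) hA1 (mem_genGroup hm)
      have h2 : (d : ℤ) • A.2 = d • A.2 := natCast_zsmul _ _
      change (m : Fin n → ℤ) ∈ groupT G
      simpa [h2] using this
    · rintro _ ⟨m, hm, rfl⟩
      set Q := AddSubgroup.closure {x | ∃ d, 0 < d ∧ x ∈ coordFamily b A d} with hQ
      -- The induction runs over all of `genGroup G`, since an element of degree 0 is generated by
      -- elements of other degrees; `p - p.1 A` is the projection to degree 0 along `A`.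
      have key : ∀ p ∈ genGroup G, ∀ m : groupM G, (m : Fin n → ℤ) = p.2 - p.1 • A.2 →
          coordHom b m ∈ Q := by
        intro p hp
        induction hp using AddSubgroup.closure_induction with
        | mem p hp =>
          intro m hm
          rcases (hG.1 p hp).lt_or_eq with hlt | heq
          · obtain ⟨d, hd⟩ := Int.eq_ofNat_of_zero_le hlt.le
            refine AddSubgroup.subset_closure ⟨d, by omega, m, ?_, rfl⟩
            convert SetLike.mem_coe.1 hp using 1
            ext i
            · simp [hd]
            · simp [hm, hd]
          -- The family starts in degree 1, so an element of degree 0 is represented after adding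
          -- `A`.
          · refine AddSubgroup.subset_closure ⟨1, one_pos, m, ?_, rfl⟩
            convert G.add_mem hA hp using 1
            ext i
            · simp [hA1, ← heq]
            · simp [hm, ← heq]
        | zero =>
          intro m hm
          have : m = 0 := by ext1; simpa using hm
          rw [this, map_zero]
          exact Q.zero_mem
        | add p q hp hq ihp ihq =>
          intro m hm
          set mp : groupM G := ⟨_, le_saturation _ (sub_smul_mem_groupT (mem_genGroup hA) hA1 hp)⟩
            with hmp
          set mq : groupM G := ⟨_, le_saturation _ (sub_smul_mem_groupT (mem_genGroup hA) hA1 hq)⟩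
            with hmq
          have : m = mp + mq := by
            ext1
            rw [hm, AddSubgroup.coe_add, hmp, hmq]
            simp only [Prod.snd_add, Prod.fst_add, add_smul]
            abel
          rw [this, map_add]
          exact Q.add_mem (ihp mp rfl) (ihq mq rfl)
        | neg p hp ihp =>
          intro m hm
          have : coordHom b (-m) ∈ Q := ihp (-m) (by
            rw [AddSubgroup.coe_neg, hm]
            simp only [Prod.snd_neg, Prod.fst_neg, neg_smul]
            abel)
          rw [map_neg] at this
          simpa using Q.neg_mem this
      exact key (0, m) hm m (by simp)

/-- The elements of degree `d` are in bijection with the translated elements in coordinates. -/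
lemma image_coordFamily (hA : A ∈ G) (hA1 : A.1 = 1) (d : ℕ) :
    degPart G d = (fun m : groupM G => (((d : ℤ), d • A.2 + (m : Fin n → ℤ)) : IntPts n)) ''
      {m | ((d : ℤ), d • A.2 + (m : Fin n → ℤ)) ∈ G} := by
  ext p
  constructor
  · rintro ⟨hp, hpd⟩
    have h := le_saturation _ (sub_smul_mem_groupT (mem_genGroup hA) hA1 (mem_genGroup hp))
    have h2 : ((d : ℤ), d • A.2 + (p.2 - p.1 • A.2)) = p := by
      ext i
      · exact hpd.symm
      · simp [hpd]
    exact ⟨⟨_, h⟩, by rw [Set.mem_ofPred_eq, h2]; exact hp, h2⟩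
  · rintro ⟨m, hm, rfl⟩
    exact ⟨hm, rfl⟩

lemma coordFamily_eq_image (d : ℕ) : coordFamily b A d =
    coordHom b '' {m : groupM G | ((d : ℤ), d • A.2 + (m : Fin n → ℤ)) ∈ G} := rfl

lemma injective_translate (d : ℕ) : Function.Injective
    fun m : groupM G => (((d : ℤ), d • A.2 + (m : Fin n → ℤ)) : IntPts n) := fun m m' h => by
  ext1
  simpa using h

lemma ncard_coordFamily (hA : A ∈ G) (hA1 : A.1 = 1) (d : ℕ) :
    (coordFamily b A d).ncard = hilbert G d := by
  rw [hilbert, image_coordFamily hA hA1, Set.ncard_image_of_injective _ (injective_translate d),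
    coordFamily_eq_image, Set.ncard_image_of_injective _ (coordHom_injective b)]

lemma finite_coordFamily_iff (hA : A ∈ G) (hA1 : A.1 = 1) (d : ℕ) :
    (coordFamily b A d).Finite ↔ (degPart G d).Finite := by
  rw [image_coordFamily hA hA1, Set.finite_image_iff (injective_translate d).injOn,
    coordFamily_eq_image, Set.finite_image_iff (coordHom_injective b).injOn]

end Family

end NewtonBody

namespace NewtonBody

/-! ### The linear bound from limited growth. -/

section LinearBound

variable {n k : ℕ} {G : AddSubsemigroup (IntPts n)}

lemma groupM_eq_top (hc : CompleteRank G) : groupM G = ⊤ := by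
  rw [eq_top_iff]
  intro m _
  have : (genGroup G).FiniteIndex := hc
  obtain ⟨l, hl, hlG⟩ := AddSubgroup.exists_nsmul_mem_of_index_ne_zero
    (AddSubgroup.FiniteIndex.index_ne_zero (H := genGroup G)) ((0, m) : IntPts n)
  refine ⟨l, hl, ?_⟩
  change ((0, l • m) : IntPts n) ∈ genGroup G
  simpa using hlG.2

lemma nonempty_basis_groupM (hc : CompleteRank G) :
    Nonempty (Module.Basis (Fin n) ℤ (groupM G)) :=
  ⟨(Pi.basisFun ℤ (Fin n)).map (AddSubgroup.topEquiv.symm.trans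
    (AddEquiv.addSubgroupCongr (groupM_eq_top hc).symm)).toIntLinearEquiv⟩

lemma IsGraded.exists_degree_one (hG : IsGraded G) : ∃ A ∈ G, A.1 = 1 := by
  obtain ⟨m, hm⟩ := hG.2 1 one_pos
  exact ⟨_, hm, by simp⟩

variable (b : Module.Basis (Fin k) ℤ (groupM G)) {A : IntPts n}

lemma exists_mem_ratioSet (hA : A ∈ G) (hA1 : A.1 = 1) {p : IntPts n} (hp : p ∈ G) (hp0 : 0 < p.1) :
    ∃ c ∈ ratioSet (coordFamily b A),
      realVec p.2 = (p.1 : ℝ) • (realVec A.2 + paramMap b c) := by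
  obtain ⟨d, hd⟩ := Int.eq_ofNat_of_zero_le hp0.le
  have hd0 : (d : ℝ) ≠ 0 := by
    have : 0 < d := by omega
    positivity
  set m : groupM G := ⟨_, le_saturation _ (sub_smul_mem_groupT (mem_genGroup hA) hA1
    (mem_genGroup hp))⟩ with hm
  refine ⟨(d : ℝ)⁻¹ • coordHom b m, ⟨d, by omega, m, ?_, (smul_inv_smul₀ hd0 _).symm⟩, ?_⟩
  · convert hp using 1
    ext i
    · simp [hd]
    · simp [hm, hd]
  · rw [map_smul, paramMap_coordHom, hm, realVec_sub, realVec_zsmul, hd, Int.cast_natCast, smul_add,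
      smul_inv_smul₀ hd0, add_sub_cancel]

lemma exists_of_mem_ratioSet {c : Fin k → ℝ} (hc : c ∈ ratioSet (coordFamily b A)) :
    ∃ p ∈ G, 0 < p.1 ∧ realVec p.2 = (p.1 : ℝ) • (realVec A.2 + paramMap b c) := by
  obtain ⟨d, hd, m, hm, hmc⟩ := hc
  refine ⟨_, hm, by simpa using hd, ?_⟩
  rw [realVec_add, realVec_nsmul, ← paramMap_coordHom b, hmc, map_smul, smul_add]
  simp

/-- A graded semigroup of complete rank and limited growth lies in a cone `‖m‖ ≤ R h`. -/
lemma exists_linear_bound (hG : IsGraded G) (hc : CompleteRank G) (hl : LimitedGrowth G) :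
    ∃ R : ℝ, ∀ p ∈ G, ‖realVec p.2‖ ≤ R * (p.1 : ℝ) := by
  obtain ⟨b⟩ := nonempty_basis_groupM hc
  obtain ⟨A, hA, hA1⟩ := hG.exists_degree_one
  obtain ⟨hfin, q, hq⟩ := hl
  have := isZLattice_coordLattice b (T := groupT G) fun m hm => hm
  have hb := (isGradedFamily_coordFamily b hG hA hA1).isBounded_ratioSet
    (fun d hd => (finite_coordFamily_iff b hA hA1 d).2 (hfin d hd)) (q := q) (fun d hd => by
      rw [ncard_coordFamily b hA hA1]
      exact (hq d hd).le)
  obtain ⟨B, hB⟩ := hb.closure.isCompact_closure.exists_bound_of_continuousOn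
    (f := fun c => realVec A.2 + paramMap b c)
    (by have := (paramMap_isClosedEmbedding b).continuous; fun_prop)
  have hpos : ∀ p ∈ G, 0 < p.1 → ‖realVec p.2‖ ≤ B * (p.1 : ℝ) := by
    intro p hp hp0
    obtain ⟨c, hc, hpc⟩ := exists_mem_ratioSet b hA hA1 hp hp0
    have hp0' : (0 : ℝ) < p.1 := by exact_mod_cast hp0
    rw [hpc, norm_smul, Real.norm_of_nonneg hp0'.le, mul_comm]
    gcongr
    exact hB c (subset_closure (subset_closure hc))
  refine ⟨B, fun p hp => ?_⟩
  rcases (hG.1 p hp).lt_or_eq with hlt | heq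
  · exact hpos p hp hlt
  -- Multiples of a degree 0 element can be added to `A` without leaving the bounded degree 1
  -- section, which forces the element to be zero.
  · have hmem : ∀ l : ℕ, A + l • p ∈ G := by
      intro l
      induction l with
      | zero => simpa using hA
      | succ l ih => rw [succ_nsmul, ← add_assoc]; exact G.add_mem ih hp
    have hle : ∀ l : ℕ, l * ‖realVec p.2‖ ≤ B + ‖realVec A.2‖ := by
      intro l
      have h1 := hpos _ (hmem l) (by simp [hA1, ← heq])
      have h2 : realVec (A + l • p).2 = realVec A.2 + (l : ℝ) • realVec p.2 := by
        rw [← realVec_nsmul, ← realVec_add]; rfl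
      have h3 : (A + l • p).1 = 1 := by simp [hA1, ← heq]
      rw [h2, h3, Int.cast_one, mul_one] at h1
      calc (l : ℝ) * ‖realVec p.2‖ = ‖(l : ℝ) • realVec p.2‖ := by
            rw [norm_smul, Real.norm_of_nonneg (Nat.cast_nonneg _)]
        _ = ‖(realVec A.2 + (l : ℝ) • realVec p.2) - realVec A.2‖ := by rw [add_sub_cancel_left]
        _ ≤ B + ‖realVec A.2‖ := (norm_sub_le _ _).trans (by gcongr)
    have hz : ‖realVec p.2‖ ≤ 0 := by
      by_contra! hcon
      obtain ⟨l, hl⟩ := exists_nat_gt ((B + ‖realVec A.2‖) / ‖realVec p.2‖)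
      rw [div_lt_iff₀ hcon] at hl
      exact absurd (hle l) (not_le.2 hl)
    simpa [← heq] using hz

end LinearBound

/-! ### The closed convex cone of a semigroup. -/

section Cone

variable {n : ℕ} (G : AddSubsemigroup (IntPts n))

lemma isClosed_coneC : IsClosed (coneC G) := isClosed_closure

lemma convex_coneC : Convex ℝ (coneC G) := (convex_convexHull ℝ _).closure

lemma zero_mem_coneC : (0 : RealPts n) ∈ coneC G :=
  subset_closure (subset_convexHull ℝ _ (by simp))

variable {G}

lemma realPt_mem_coneC {p : IntPts n} (hp : p ∈ G) : realPt p ∈ coneC G :=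
  subset_closure (subset_convexHull ℝ _ (Or.inl ⟨p, hp, rfl⟩))

lemma coneC_subset {Z : Set (RealPts n)} (hcl : IsClosed Z) (hcv : Convex ℝ Z) (h0 : 0 ∈ Z)
    (hG : ∀ p ∈ G, realPt p ∈ Z) : coneC G ⊆ Z := by
  refine closure_minimal (convexHull_min ?_ hcv) hcl
  rintro x (⟨p, hp, rfl⟩ | rfl)
  · exact hG p hp
  · exact h0

lemma nsmul_mem_semigroup {p : IntPts n} (hp : p ∈ G) {l : ℕ} (hl : 0 < l) : l • p ∈ G := by
  induction l, hl using Nat.le_induction with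
  | base => simpa using hp
  | succ d _ ih => rw [succ_nsmul]; exact G.add_mem ih hp

lemma realPt_nsmul (l : ℕ) (p : IntPts n) : realPt (l • p) = (l : ℝ) • realPt p := by
  refine Prod.ext ?_ (realVec_nsmul l p.2)
  simp [realPt]

/-- For a generator `p` and an integer `l > r`, the point `r p` lies on the segment from `0` to `l
p`, and `l p` is again in `G`. -/
lemma smul_mem_coneC {r : ℝ} (hr : 0 ≤ r) {x : RealPts n} (hx : x ∈ coneC G) :
    r • x ∈ coneC G := by
  have hsub : coneC G ⊆ (fun x => r • x) ⁻¹' coneC G := by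
    refine coneC_subset ((isClosed_coneC G).preimage (continuous_const_smul r))
      ((convex_coneC G).is_linear_preimage (LinearMap.lsmul ℝ (RealPts n) r).isLinear) ?_ ?_
    · simpa using zero_mem_coneC G
    · intro p hp
      obtain ⟨l, hl⟩ := exists_nat_gt r
      have hl0 : (0 : ℝ) < l := hr.trans_lt hl
      have h1 := realPt_mem_coneC (nsmul_mem_semigroup hp (l := l) (by exact_mod_cast hl0))
      have h2 := (convex_coneC G).smul_mem_of_zero_mem (zero_mem_coneC G) h1
        (t := r / l) ⟨by positivity, (div_le_one hl0).2 hl.le⟩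
      rw [realPt_nsmul, smul_smul, div_mul_cancel₀ _ hl0.ne'] at h2
      exact h2
  exact hsub hx

end Cone

/-! ### Linear coordinates on `V(G)`. -/

section Shear

variable {n k : ℕ} {G : AddSubsemigroup (IntPts n)} (b : Module.Basis (Fin k) ℤ (groupM G))
  (A : IntPts n)

/-- The linear parametrisation `(h, e) ↦ h A + e` of the space `V(G)`. -/
noncomputable def shearMap : (ℝ × (Fin k → ℝ)) →ₗ[ℝ] RealPts n :=
  (LinearMap.fst ℝ ℝ (Fin k → ℝ)).prod
    ((LinearMap.fst ℝ ℝ (Fin k → ℝ)).smulRight (realVec A.2) +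
      paramMap b ∘ₗ LinearMap.snd ℝ ℝ (Fin k → ℝ))

lemma shearMap_apply (h : ℝ) (e : Fin k → ℝ) :
    shearMap b A (h, e) = (h, h • realVec A.2 + paramMap b e) := rfl

lemma shearMap_injective : Function.Injective (shearMap b A) := by
  rintro ⟨h, e⟩ ⟨h', e'⟩ heq
  rw [shearMap_apply, shearMap_apply, Prod.mk.injEq] at heq
  obtain ⟨rfl, h2⟩ := heq
  rw [paramMap_injective b (add_left_cancel h2)]

lemma shearMap_continuous : Continuous (shearMap b A) :=
  LinearMap.continuous_of_finiteDimensional _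

variable {A}

lemma shearMap_coordHom (hA1 : A.1 = 1) (l : ℤ) (m : groupM G) :
    shearMap b A (l, coordHom b m) = realPt (l • A + (0, (m : Fin n → ℤ))) := by
  rw [shearMap_apply, paramMap_coordHom]
  refine Prod.ext ?_ ?_
  · simp [realPt, hA1]
  · rw [← realVec_zsmul, ← realVec_add]; rfl

lemma spaceV_eq_range (hA1 : A.1 = 1) : spaceV G A = LinearMap.range (shearMap b A) := by
  have hin : ∀ (l : ℤ) (m : groupM G), shearMap b A (l, coordHom b m) ∈ spaceV G A := by
    intro l m
    rw [shearMap_coordHom b hA1]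
    refine Submodule.subset_span ⟨_, AddSubgroup.mem_sup.2 ⟨l • A, ⟨l, rfl⟩, _, ⟨m, m.2, rfl⟩, rfl⟩,
      rfl⟩
  refine le_antisymm ?_ ?_
  · rw [spaceV, Submodule.span_le]
    rintro _ ⟨p, hp, rfl⟩
    obtain ⟨_, ⟨l, rfl⟩, _, ⟨m, hm, rfl⟩, rfl⟩ := AddSubgroup.mem_sup.1 hp
    exact ⟨_, shearMap_coordHom b hA1 l ⟨m, hm⟩⟩
  · rintro _ ⟨⟨h, e⟩, rfl⟩
    have h1 : ((h, e) : ℝ × (Fin k → ℝ)) = h • (((1 : ℤ) : ℝ), coordHom b (0 : groupM G))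
        + ∑ i, e i • (((0 : ℤ) : ℝ), coordHom b (b i)) := by
      refine Prod.ext ?_ ?_
      · simp [Prod.fst_sum]
      · ext j
        simp [Prod.snd_sum, coordHom_apply, Finsupp.single_apply]
    rw [h1, map_add, map_smul, map_sum]
    refine Submodule.add_mem _ (Submodule.smul_mem _ _ (hin _ _)) (Submodule.sum_mem _ fun i _ => ?_)
    rw [map_smul]
    exact Submodule.smul_mem _ _ (hin _ _)

lemma finrank_spaceV (b : Module.Basis (Fin k) ℤ (groupM G)) (hA1 : A.1 = 1) :
    Module.finrank ℝ (spaceV G A) = k + 1 := by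
  rw [spaceV_eq_range b hA1, LinearMap.finrank_range_of_inj (shearMap_injective b A),
    Module.finrank_prod, Module.finrank_self, Module.finrank_fin_fun, add_comm]

end Shear

end NewtonBody

namespace NewtonBody

/-! ### The Newton body in coordinates, approximation and asymptotics. -/

section Body

variable {n k : ℕ} {G : AddSubsemigroup (IntPts n)} (b : Module.Basis (Fin k) ℤ (groupM G))
  (A : IntPts n)

/-- The Newton body, translated by `-A` and in the coordinates given by the basis `b`. -/
def coordBody : Set (Fin k → ℝ) := closure (convexHull ℝ (ratioSet (coordFamily b A)))

lemma convex_coordBody : Convex ℝ (coordBody b A) := (convex_convexHull ℝ _).closure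

lemma ratioSet_subset_coordBody : ratioSet (coordFamily b A) ⊆ coordBody b A :=
  (subset_convexHull ℝ _).trans subset_closure

variable {A}

lemma isBounded_ratioSet_coordFamily {R : ℝ} (hR : ∀ p ∈ G, ‖realVec p.2‖ ≤ R * (p.1 : ℝ)) :
    Bornology.IsBounded (ratioSet (coordFamily b A)) := by
  refine ((paramMap_isClosedEmbedding b).isCompact_preimage
    (isCompact_closedBall (0 : EuclideanSpace ℝ (Fin n)) (R + ‖realVec A.2‖))).isBounded.subset ?_
  intro c hc
  obtain ⟨p, hp, hp0, hpc⟩ := exists_of_mem_ratioSet b hc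
  have hp0' : (0 : ℝ) < p.1 := by exact_mod_cast hp0
  have h1 := hR p hp
  rw [hpc, norm_smul, Real.norm_of_nonneg hp0'.le, mul_comm, mul_le_mul_iff_left₀ hp0'] at h1
  rw [Set.mem_preimage, mem_closedBall_zero_iff]
  calc ‖paramMap b c‖ = ‖(realVec A.2 + paramMap b c) - realVec A.2‖ := by
        rw [add_sub_cancel_left]
    _ ≤ R + ‖realVec A.2‖ := (norm_sub_le _ _).trans (by gcongr)

lemma isCompact_coordBody {R : ℝ} (hR : ∀ p ∈ G, ‖realVec p.2‖ ≤ R * (p.1 : ℝ)) :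
    IsCompact (coordBody b A) :=
  (isBounded_convexHull.2 (isBounded_ratioSet_coordFamily b hR)).isCompact_closure

lemma shearMap_smul_mem (r : ℝ) (c : Fin k → ℝ) :
    shearMap b A (r, r • c) = r • shearMap b A (1, c) := by
  rw [← map_smul, Prod.smul_mk, smul_eq_mul, mul_one]

/-- The cone `C(G)` in the coordinates of `V(G)`. -/
lemma mem_coneC_iff {R : ℝ} (hG : IsGraded G) (hA : A ∈ G) (hA1 : A.1 = 1)
    (hR : ∀ p ∈ G, ‖realVec p.2‖ ≤ R * (p.1 : ℝ)) {x : RealPts n} :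
    x ∈ coneC G ↔ ∃ r : ℝ, 0 ≤ r ∧ ∃ c ∈ coordBody b A, shearMap b A (r, r • c) = x := by
  have hX := isCompact_coordBody b (A := A) hR
  have hXc := convex_coordBody b A
  have hXne : (0 : Fin k → ℝ) ∈ coordBody b A :=
    ratioSet_subset_coordBody b A (isGradedFamily_coordFamily b hG hA hA1).zero_mem_ratioSet
  constructor
  · set Z : Set (RealPts n) :=
      {x | ∃ r : ℝ, 0 ≤ r ∧ ∃ c ∈ coordBody b A, shearMap b A (r, r • c) = x} with hZ
    suffices coneC G ⊆ Z from fun hx => this hx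
    refine coneC_subset ?_ ?_ ⟨0, le_rfl, 0, hXne, by rw [smul_zero]; exact map_zero (shearMap b A)⟩ ?_
    -- The height `r` is the first coordinate, so it converges by itself; compactness of the body
    -- gives a convergent subsequence of the `c`.
    · refine IsSeqClosed.isClosed fun u x hu hux => ?_
      choose r hr c hc hrc using hu
      obtain ⟨c₀, hc₀, φ, hφ, hlim⟩ := hX.tendsto_subseq hc
      have hux' : Tendsto (fun j => u (φ j)) atTop (𝓝 x) := hux.comp hφ.tendsto_atTop
      have hr' : ∀ j, (u (φ j)).1 = r (φ j) := fun j => by rw [← hrc]; rfl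
      have hrlim : Tendsto (fun j => r (φ j)) atTop (𝓝 x.1) := by
        exact ((continuous_fst.tendsto x).comp hux').congr hr'
      refine ⟨x.1, ge_of_tendsto' hrlim fun j => hr _, c₀, hc₀, ?_⟩
      refine tendsto_nhds_unique ?_ hux'
      have := ((shearMap_continuous b A).tendsto (x.1, x.1 • c₀)).comp
        (hrlim.prodMk_nhds (hrlim.smul hlim))
      simpa only [Function.comp_def, hrc] using this
    · rintro _ ⟨r, hr, c, hc, rfl⟩ _ ⟨r', hr', c', hc', rfl⟩ s t hs ht hst
      have hsr : 0 ≤ s * r := by positivity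
      have hsr' : 0 ≤ t * r' := by positivity
      rcases (add_nonneg hsr hsr').lt_or_eq with hpos | heq
      · refine ⟨s * r + t * r', hpos.le, (s * r / (s * r + t * r')) • c
          + (t * r' / (s * r + t * r')) • c', ?_, ?_⟩
        · refine hXc hc hc' (by positivity) (by positivity) ?_
          rw [← add_div, div_self hpos.ne']
        · rw [← map_smul, ← map_smul, ← map_add]
          congr 1
          refine Prod.ext (by simp) ?_
          simp only [smul_add, smul_smul, Prod.snd_add, Prod.smul_snd]
          rw [mul_div_cancel₀ _ hpos.ne', mul_div_cancel₀ _ hpos.ne']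
      · have h1 : s * r = 0 := by linarith
        have h2 : t * r' = 0 := by linarith
        refine ⟨0, le_rfl, 0, hXne, ?_⟩
        rw [← map_smul, ← map_smul, ← map_add]
        congr 1
        refine Prod.ext ?_ ?_
        · simp [h1, h2]
        · simp [smul_smul, h1, h2]
    · intro p hp
      rcases (hG.1 p hp).lt_or_eq with hlt | heq
      · obtain ⟨c, hc, hpc⟩ := exists_mem_ratioSet b hA hA1 hp hlt
        refine ⟨p.1, by exact_mod_cast hlt.le, c, ratioSet_subset_coordBody b A hc, ?_⟩
        rw [shearMap_apply, map_smul, ← smul_add, ← hpc]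
        rfl
      · refine ⟨0, le_rfl, 0, hXne, ?_⟩
        have h1 := hR p hp
        rw [← heq, Int.cast_zero, mul_zero] at h1
        have h2 : realVec p.2 = 0 := norm_le_zero_iff.1 h1
        rw [smul_zero]
        change shearMap b A 0 = _
        rw [map_zero]
        exact Prod.ext (by simp [realPt, ← heq]) h2.symm
  · rintro ⟨r, hr, c, hc, rfl⟩
    rw [shearMap_smul_mem]
    refine smul_mem_coneC hr ?_
    have hsub : coordBody b A ⊆ (fun c => shearMap b A (1, c)) ⁻¹' coneC G := by
      refine closure_minimal (convexHull_min ?_ ?_) ?_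
      · intro c hc
        obtain ⟨p, hp, hp0, hpc⟩ := exists_of_mem_ratioSet b hc
        have hp0' : (0 : ℝ) < p.1 := by exact_mod_cast hp0
        have h1 : realPt p = (p.1 : ℝ) • shearMap b A (1, c) := by
          rw [← shearMap_smul_mem, shearMap_apply, map_smul, ← smul_add, ← hpc]
          rfl
        have h2 := smul_mem_coneC (r := (p.1 : ℝ)⁻¹) (by positivity) (realPt_mem_coneC hp)
        rw [h1, inv_smul_smul₀ hp0'.ne'] at h2
        exact h2
      · intro c hc c' hc' s t hs ht hst
        have := convex_coneC G hc hc' hs ht hst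
        simp only [← map_smul, ← map_add, Prod.smul_mk, Prod.mk_add_mk, smul_eq_mul, mul_one,
          hst] at this
        exact this
      · exact (isClosed_coneC G).preimage ((shearMap_continuous b A).comp (by fun_prop))
    exact hsub hc

variable {R : ℝ} (hG : IsGraded G) (hA : A ∈ G) (hA1 : A.1 = 1)
    (hR : ∀ p ∈ G, ‖realVec p.2‖ ≤ R * (p.1 : ℝ))
include b hG hA hA1 hR

lemma add_paramMap_mem_newtonBody_iff {c : Fin k → ℝ} :
    realVec A.2 + paramMap b c ∈ newtonBody G ↔ c ∈ coordBody b A := by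
  change ((1 : ℝ), _) ∈ coneC G ↔ _
  have h1 : ((1 : ℝ), realVec A.2 + paramMap b c) = shearMap b A (1, (1 : ℝ) • c) := by
    rw [shearMap_apply, one_smul, one_smul]
  rw [h1, mem_coneC_iff b hG hA hA1 hR]
  constructor
  · rintro ⟨r, _, c', hc', h⟩
    have := shearMap_injective b A h
    rw [Prod.mk.injEq] at this
    obtain ⟨rfl, h2⟩ := this
    rw [one_smul, one_smul] at h2
    rwa [← h2]
  · exact fun hc => ⟨1, zero_le_one, c, hc, rfl⟩

lemma newtonBody_eq_image :
    newtonBody G = (fun c => realVec A.2 + paramMap b c) '' coordBody b A := by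
  ext x
  constructor
  · intro hx
    obtain ⟨r, _, c, hc, h⟩ := (mem_coneC_iff b hG hA hA1 hR).1 hx
    rw [shearMap_apply, Prod.mk.injEq] at h
    obtain ⟨rfl, h2⟩ := h
    rw [one_smul, one_smul] at h2
    exact ⟨c, hc, h2⟩
  · rintro ⟨c, hc, rfl⟩
    exact (add_paramMap_mem_newtonBody_iff b hG hA hA1 hR).2 hc

lemma isCompact_newtonBody : IsCompact (newtonBody G) := by
  rw [newtonBody_eq_image b hG hA hA1 hR]
  refine (isCompact_coordBody b hR).image ?_
  have := (paramMap_isClosedEmbedding b).continuous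
  fun_prop

lemma span_ratioSet_coordFamily : Submodule.span ℝ (ratioSet (coordFamily b A)) = ⊤ := by
  have := isZLattice_coordLattice b (T := groupT G) fun m hm => hm
  exact (isGradedFamily_coordFamily b hG hA hA1).span_ratioSet

lemma finrank_vectorSpan_newtonBody :
    Module.finrank ℝ (vectorSpan ℝ (newtonBody G)) = k := by
  have h0 : (0 : Fin k → ℝ) ∈ coordBody b A :=
    ratioSet_subset_coordBody b A (isGradedFamily_coordFamily b hG hA hA1).zero_mem_ratioSet
  have h1 : vectorSpan ℝ (coordBody b A) = ⊤ := by
    rw [vectorSpan_eq_span_vsub_set_right ℝ h0, eq_top_iff,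
      ← span_ratioSet_coordFamily b hG hA hA1 hR]
    refine Submodule.span_mono fun c hc => ⟨c, ratioSet_subset_coordBody b A hc, by simp⟩
  have h2 : newtonBody G = (AffineMap.const ℝ (Fin k → ℝ) (realVec A.2)
      + (paramMap b).toAffineMap : (Fin k → ℝ) →ᵃ[ℝ] EuclideanSpace ℝ (Fin n)) ''
      coordBody b A := newtonBody_eq_image b hG hA hA1 hR
  rw [h2, ← AffineMap.map_vectorSpan, h1, Submodule.map_top]
  have h3 : (AffineMap.const ℝ (Fin k → ℝ) (realVec A.2)
      + (paramMap b).toAffineMap : (Fin k → ℝ) →ᵃ[ℝ] EuclideanSpace ℝ (Fin n)).linear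
      = paramMap b := by
    ext; simp
  rw [h3, LinearMap.finrank_range_of_inj (paramMap_injective b), Module.finrank_fin_fun]

lemma coneC_subset_spaceV : coneC G ⊆ spaceV G A := by
  intro x hx
  obtain ⟨r, _, c, _, rfl⟩ := (mem_coneC_iff b hG hA hA1 hR).1 hx
  rw [spaceV_eq_range b hA1]
  exact ⟨_, rfl⟩

/-- The point over `0` at height 1 gives the direction of `A`; its differences with the other points
at height 1 give all horizontal directions, because the ratios span `ℝᵏ`. -/
lemma span_coneC : Submodule.span ℝ (coneC G) = spaceV G A := by
  refine le_antisymm (Submodule.span_le.2 (coneC_subset_spaceV b hG hA hA1 hR)) ?_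
  rw [spaceV_eq_range b hA1]
  have hone : ∀ c ∈ coordBody b A, shearMap b A (1, c) ∈ Submodule.span ℝ (coneC G) := by
    intro c hc
    refine Submodule.subset_span ((mem_coneC_iff b hG hA hA1 hR).2 ⟨1, zero_le_one, c, hc, ?_⟩)
    rw [one_smul]
  have h0 : (0 : Fin k → ℝ) ∈ coordBody b A :=
    ratioSet_subset_coordBody b A (isGradedFamily_coordFamily b hG hA hA1).zero_mem_ratioSet
  have hle : Submodule.span ℝ (ratioSet (coordFamily b A)) ≤ (Submodule.span ℝ (coneC G)).comap
      (shearMap b A ∘ₗ LinearMap.inr ℝ ℝ (Fin k → ℝ)) := by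
    rw [Submodule.span_le]
    intro c hc
    have := Submodule.sub_mem _ (hone c (ratioSet_subset_coordBody b A hc)) (hone 0 h0)
    rw [← map_sub, Prod.mk_sub_mk, sub_self, sub_zero] at this
    exact this
  rw [span_ratioSet_coordFamily b hG hA hA1 hR] at hle
  rintro _ ⟨⟨h, e⟩, rfl⟩
  have h1 : ((h, e) : ℝ × (Fin k → ℝ)) = h • (1, 0) + (0, e) := by simp
  rw [h1, map_add, map_smul]
  exact Submodule.add_mem _ (Submodule.smul_mem _ _ (hone 0 h0)) (hle (x := e) trivial)

lemma isPositiveCone_coneC : IsPositiveCone (spaceV G A) (coneC G) where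
  isClosed := isClosed_coneC G
  convex := convex_coneC G
  smul_mem r hr x hx := smul_mem_coneC hr hx
  span_eq := span_coneC b hG hA hA1 hR
  nonneg x hx := by
    obtain ⟨r, hr, c, _, rfl⟩ := (mem_coneC_iff b hG hA hA1 hR).1 hx
    exact hr
  inter_eq := by
    refine Set.Subset.antisymm ?_ ?_
    · rintro x ⟨hx, hx0⟩
      obtain ⟨r, hr, c, _, rfl⟩ := (mem_coneC_iff b hG hA hA1 hR).1 hx
      have : r = 0 := hx0
      rw [this, zero_smul]
      exact map_zero (shearMap b A)
    · rintro _ rfl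
      exact ⟨zero_mem_coneC G, rfl⟩

lemma hasType_coneC : HasType (spaceV G A) (groupM G) (coneC G) (groupT G) A
    (typeSet (coneC G) (groupT G) A) where
  cone := isPositiveCone_coneC b hG hA hA1 hR
  le := le_saturation _
  finiteIndex := relIndex_saturation_ne_zero _
  mem := coneC_subset_spaceV b hG hA hA1 hR (realPt_mem_coneC hA)
  degree := hA1
  eq := rfl

omit b hG hR in
lemma subset_typeSet : (G : Set (IntPts n)) ⊆ typeSet (coneC G) (groupT G) A := by
  intro p hp
  refine ⟨realPt_mem_coneC hp, p.1, _,
    sub_smul_mem_groupT (mem_genGroup hA) hA1 (mem_genGroup hp), ?_⟩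
  ext i <;> simp [hA1]

/-- Points over the frontier of the body in coordinates lie on the boundary of the section. -/
lemma smul_shearMap_mem_sectionBoundary {d : ℕ} (hd : 0 < d) {y : Fin k → ℝ}
    (hy : y ∈ frontier (coordBody b A)) :
    (d : ℝ) • shearMap b A (1, y) ∈ sectionBoundary (spaceV G A) (coneC G) d := by
  have hd' : (0 : ℝ) < d := by exact_mod_cast hd
  have hyX : y ∈ coordBody b A := by
    have : IsClosed (coordBody b A) := isClosed_closure
    exact this.frontier_subset hy
  refine ⟨⟨?_, ?_⟩, ?_⟩
  · exact (mem_coneC_iff b hG hA hA1 hR).2 ⟨d, hd'.le, y, hyX, shearMap_smul_mem b _ _⟩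
  · simp [shearMap_apply]
  · have hcont : Continuous fun y => (d : ℝ) • shearMap b A (1, y) :=
      (continuous_const_smul (d : ℝ)).comp
        ((shearMap_continuous b A).comp (Continuous.prodMk_right (1 : ℝ)))
    have hy' : y ∈ closure (coordBody b A)ᶜ := by
      rw [frontier_eq_closure_inter_closure] at hy
      exact hy.2
    refine map_mem_closure (f := fun y => (d : ℝ) • shearMap b A (1, y)) hcont hy' fun y' hy' => ⟨?_, by simp [shearMap_apply], fun hcon => hy' ?_⟩
    · rw [spaceV_eq_range b hA1]
      exact Submodule.smul_mem _ _ ⟨_, rfl⟩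
    · have h1 := smul_mem_coneC (r := (d : ℝ)⁻¹) (by positivity) hcon
      rw [inv_smul_smul₀ hd'.ne', shearMap_apply, one_smul] at h1
      exact (add_paramMap_mem_newtonBody_iff b hG hA hA1 hR).1 h1

/-- Points of the body at distance at least `ε` from its frontier form a compact set of interior
points. There `G` eventually has all lattice points, so in degree `d` a missing point is within `d
ε` of the boundary. -/
lemma approximates_coneC :
    Approximates (spaceV G A) (coneC G) (typeSet (coneC G) (groupT G) A) G := by
  refine ⟨subset_typeSet hA hA1, ENNReal.tendsto_nhds_zero.2 fun ε hε => ?_⟩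
  have := isZLattice_coordLattice b (T := groupT G) fun m hm => hm
  have hfam := isGradedFamily_coordFamily b hG hA hA1
  set X := coordBody b A with hX
  set ψ : (Fin k → ℝ) → RealPts n := fun c => shearMap b A (1, c) with hψ
  have hψc : Continuous ψ := (shearMap_continuous b A).comp (by fun_prop)
  -- For `k = 0` the frontier is empty, the extended distance is infinite, and `K` is all of `X`.
  set K : Set (Fin k → ℝ) := X ∩ {c | ε ≤ Metric.infEDist (ψ c) (ψ '' frontier X)} with hK
  have hKc : IsCompact K := (isCompact_coordBody b hR).inter_right
    (isClosed_le continuous_const (Metric.continuous_infEDist.comp hψc))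
  have hKi : K ⊆ interior (convexHull ℝ (ratioSet (coordFamily b A))) := by
    rw [← Convex.interior_closure_eq_interior_of_nonempty_interior (convex_convexHull ℝ _)
      hfam.interior_convexHull_nonempty]
    rintro c ⟨hcX, hc⟩
    by_contra hcon
    have hfr : c ∈ frontier X := ⟨subset_closure hcX, hcon⟩
    have : Metric.infEDist (ψ c) (ψ '' frontier X) = 0 :=
      Metric.infEDist_zero_of_mem ⟨c, hfr, rfl⟩
    rw [Set.mem_ofPred_eq, this] at hc
    exact absurd hε (not_lt.2 hc)
  filter_upwards [hfam.eventually_mem_of_isCompact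
    (fun R => finite_lattice_inter Metric.isBounded_closedBall) hKc hKi, eventually_gt_atTop 0]
    with d hd hd0
  have hd' : (0 : ℝ) < d := by exact_mod_cast hd0
  refine ENNReal.div_le_of_le_mul ?_
  refine iSup₂_le fun p hp => ?_
  obtain ⟨⟨hpC, l, t, ht, hpt⟩, hpG, hpd⟩ := hp
  have hl : l = d := by
    have := congrArg Prod.fst hpt
    simpa [hA1, hpd] using this.symm
  set m : groupM G := ⟨t, le_saturation _ ht⟩ with hm
  have hpm : realPt p = (d : ℝ) • ψ ((d : ℝ)⁻¹ • coordHom b m) := by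
    rw [hψ, ← shearMap_smul_mem, smul_inv_smul₀ hd'.ne', hpt, hl]
    have := shearMap_coordHom b hA1 (d : ℤ) m
    rw [Int.cast_natCast] at this
    exact this.symm
  have hcX : (d : ℝ)⁻¹ • coordHom b m ∈ X := by
    have h1 := smul_mem_coneC (r := (d : ℝ)⁻¹) (by positivity) hpC
    rw [hpm, inv_smul_smul₀ hd'.ne'] at h1
    change shearMap b A (1, _) ∈ coneC G at h1
    rw [shearMap_apply, one_smul] at h1
    exact (add_paramMap_mem_newtonBody_iff b hG hA hA1 hR).1 h1
  have hnK : (d : ℝ)⁻¹ • coordHom b m ∉ K := by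
    intro hmK
    obtain ⟨m', hm', heq⟩ := hd (coordHom b m) ⟨m, ht, rfl⟩ hmK
    have := coordHom_injective b heq
    subst this
    refine hpG ?_
    convert hm' using 1
    rw [hpt, hl]
    ext i <;> simp [hA1, hm]
  have hlt : Metric.infEDist (ψ ((d : ℝ)⁻¹ • coordHom b m)) (ψ '' frontier X) < ε := by
    by_contra! hcon
    exact hnK ⟨hcX, hcon⟩
  obtain ⟨_, ⟨y, hy, rfl⟩, hylt⟩ := Metric.infEDist_lt_iff.1 hlt
  refine (Metric.infEDist_le_edist_of_mem
    (smul_shearMap_mem_sectionBoundary b hG hA hA1 hR hd0 hy)).trans ?_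
  rw [hpm, edist_smul₀, mul_comm]
  have hnn : ‖(d : ℝ)‖₊ • edist (ψ ((d : ℝ)⁻¹ • coordHom b m)) (shearMap b A (1, y))
      = (d : ENNReal) * edist (ψ ((d : ℝ)⁻¹ • coordHom b m)) (ψ y) := by
    rw [ENNReal.smul_def, Real.nnnorm_natCast, smul_eq_mul, ENNReal.coe_natCast]
  rw [hnn]
  gcongr

lemma latticeVolume_newtonBody :
    latticeVolume b (realVec A.2) (newtonBody G) = volume (coordBody b A) := by
  rw [latticeVolume]
  congr 1
  ext c
  exact add_paramMap_mem_newtonBody_iff b hG hA hA1 hR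

lemma tendsto_hilbert_div :
    Tendsto (fun d : ℕ => (hilbert G d : ℝ) / (d : ℝ) ^ k) atTop
      (𝓝 ((latticeVolume b (realVec A.2) (newtonBody G)).toReal /
        ((groupT G).relIndex (groupM G) : ℝ))) := by
  have := isZLattice_coordLattice b (T := groupT G) fun m hm => hm
  have h := (isGradedFamily_coordFamily b hG hA hA1).tendsto_ncard_div
    (isBounded_ratioSet_coordFamily b hR)
  simp only [ncard_coordFamily b hA hA1] at h
  rw [covolume_coordLattice b (T := groupT G) fun m hm => hm] at h
  rwa [latticeVolume_newtonBody b hG hA hA1 hR]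

lemma finiteSections : FiniteSections G := by
  have := isZLattice_coordLattice b (T := groupT G) fun m hm => hm
  intro d hd
  exact (finite_coordFamily_iff b hA hA1 d).1
    ((isGradedFamily_coordFamily b hG hA hA1).finite_of_isBounded
      (isBounded_ratioSet_coordFamily b hR) hd)

end Body

end NewtonBody

namespace NewtonBody

/-! ### Uniqueness of the approximating semigroup. -/

section Uniqueness

variable {n : ℕ}

/-- A subgroup of index `N` contains `N ℤⁿ`, so coordinates can be rounded to multiples of `N`. -/
lemma realVec_close {T : AddSubgroup (Fin n → ℤ)} (hT : T.relIndex ⊤ ≠ 0) :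
    ∃ ρ : ℝ, 0 < ρ ∧ ∀ v : EuclideanSpace ℝ (Fin n), ∃ t ∈ T, ‖realVec t - v‖ ≤ ρ := by
  rw [AddSubgroup.relIndex_top_right] at hT
  set N := T.index with hN
  have hN0 : (0 : ℝ) < N := by exact_mod_cast Nat.pos_of_ne_zero hT
  -- The summand 1 keeps the radius positive for `n = 0`.
  refine ⟨√(∑ _i : Fin n, (N : ℝ) ^ 2) + 1, by positivity, fun v => ?_⟩
  refine ⟨N • fun i => ⌊v i / N⌋, T.nsmul_index_mem _, ?_⟩
  refine le_trans ?_ (le_add_of_nonneg_right zero_le_one)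
  rw [EuclideanSpace.norm_eq]
  refine Real.sqrt_le_sqrt (Finset.sum_le_sum fun i _ => ?_)
  have h1 := Int.floor_le (v i / N)
  have h2 := Int.lt_floor_add_one (v i / N)
  rw [le_div_iff₀ hN0] at h1
  rw [div_lt_iff₀ hN0] at h2
  rw [Real.norm_eq_abs, sq_abs, realVec_nsmul]
  simp only [PiLp.sub_apply, PiLp.smul_apply, realVec_apply, smul_eq_mul]
  exact sq_le_sq' (by linarith) (by linarith)

namespace IsPositiveCone

variable {C : Set (RealPts n)}

lemma zero_mem {V : Submodule ℝ (RealPts n)} (hC : IsPositiveCone V C) : (0 : RealPts n) ∈ C := by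
  have : (0 : RealPts n) ∈ C ∩ {x | x.1 = 0} := by rw [hC.inter_eq]; rfl
  exact this.1

lemma interior_nonempty (hC : IsPositiveCone ⊤ C) : (interior C).Nonempty := by
  rw [hC.convex.interior_nonempty_iff_affineSpan_eq_top,
    AffineSubspace.affineSpan_eq_top_iff_vectorSpan_eq_top_of_nonempty ℝ _ _ ⟨0, hC.zero_mem⟩,
    vectorSpan_eq_span_vsub_set_right ℝ hC.zero_mem]
  simpa using hC.span_eq

lemma smul_mem_interior {V : Submodule ℝ (RealPts n)} (hC : IsPositiveCone V C) {r : ℝ} (hr : 0 < r)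
    {x : RealPts n} (hx : x ∈ interior C) : r • x ∈ interior C := by
  have hsub : (fun y : RealPts n => r⁻¹ • y) ⁻¹' interior C ⊆ C := by
    intro y hy
    have := hC.smul_mem r hr.le _ (interior_subset hy)
    rwa [smul_inv_smul₀ hr.ne'] at this
  refine interior_maximal hsub (isOpen_interior.preimage (continuous_const_smul _)) ?_
  rwa [Set.mem_preimage, inv_smul_smul₀ hr.ne']

lemma pos_of_mem_interior {V : Submodule ℝ (RealPts n)} (hC : IsPositiveCone V C) {x : RealPts n}
    (hx : x ∈ interior C) : 0 < x.1 := by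
  obtain ⟨δ, hδ, hball⟩ := Metric.isOpen_iff.1 isOpen_interior x hx
  have hmem : (x.1 - δ / 2, x.2) ∈ Metric.ball x δ := by
    rw [Metric.mem_ball, Prod.dist_eq, dist_self, Real.dist_eq, max_lt_iff]
    refine ⟨?_, hδ⟩
    rw [abs_lt]
    constructor <;> simp only <;> linarith
  have := hC.nonneg _ (interior_subset (hball hmem))
  simp only at this
  linarith

/-- If the semigroup of a type approximates `G`, then `G` contains its elements of large degree
near a ray in the interior of the cone. -/
lemma eventually_mem {T : AddSubgroup (Fin n → ℤ)} {A : IntPts n} {S : Set (IntPts n)}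
    {G : AddSubsemigroup (IntPts n)} (hS : HasType ⊤ ⊤ C T A S) (hSG : Approximates ⊤ C S G)
    {x : EuclideanSpace ℝ (Fin n)} (hx : ((1 : ℝ), x) ∈ interior C) :
    ∃ ε : ℝ, 0 < ε ∧ ∀ᶠ d : ℕ in atTop, ∀ t ∈ T,
      ‖realVec (d • A.2 + t) - (d : ℝ) • x‖ < d * ε → ((d : ℤ), d • A.2 + t) ∈ G := by
  obtain ⟨δ, hδ, hball⟩ := Metric.isOpen_iff.1 isOpen_interior _ hx
  refine ⟨δ / 2, by positivity, ?_⟩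
  have hlim := hSG.2.eventually_lt_const (ENNReal.ofReal_pos.2 (half_pos hδ))
  filter_upwards [hlim, eventually_gt_atTop 0] with d hd hd0 t ht hnear
  have hd' : (0 : ℝ) < d := by exact_mod_cast hd0
  by_contra hpG
  -- The section at height `d` contains the ball of radius `d δ` around `d x`. A point within `d δ /
  -- 2` of the centre is thus at least `d δ / 2` from the boundary, too far to be missing from `G`.
  have hfar : ∀ y : EuclideanSpace ℝ (Fin n), ((d : ℝ), y) ∉ C → d * δ ≤ ‖y - (d : ℝ) • x‖ := by
    intro y hy
    by_contra! hcon
    refine hy ?_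
    have h1 : ((1 : ℝ), (d : ℝ)⁻¹ • y) ∈ C := by
      refine interior_subset (hball ?_)
      rw [Metric.mem_ball, Prod.dist_eq, dist_self, max_lt_iff]
      refine ⟨hδ, ?_⟩
      have h2 : (d : ℝ)⁻¹ • y - x = (d : ℝ)⁻¹ • (y - (d : ℝ) • x) := by
        rw [smul_sub, inv_smul_smul₀ hd'.ne']
      rw [dist_eq_norm]
      simp only
      rw [h2, norm_smul, norm_inv, Real.norm_of_nonneg hd'.le, inv_mul_lt_iff₀ hd']
      exact hcon
    have h3 := hS.cone.smul_mem d hd'.le _ h1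
    rwa [Prod.smul_mk, smul_eq_mul, mul_one, smul_inv_smul₀ hd'.ne'] at h3
  set p : IntPts n := ((d : ℤ), d • A.2 + t) with hp
  have hpr : realPt p = ((d : ℝ), realVec (d • A.2 + t)) := by simp [realPt, hp]
  have hpS : p ∈ S := by
    rw [hS.eq]
    refine ⟨?_, d, t, ht, ?_⟩
    · rw [hpr]
      by_contra hcon
      have := hfar _ hcon
      nlinarith
    · ext i <;> simp [hp, hS.degree]
  have hle : ENNReal.ofReal (d * (δ / 2)) ≤ defect ⊤ C S G d := by
    refine le_trans ?_ (le_iSup₂ (f := fun (p : IntPts n)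
      (_ : p ∈ {p : IntPts n | p ∈ S ∧ p ∉ G ∧ p.1 = (d : ℤ)}) =>
      Metric.infEDist (realPt p) (sectionBoundary ⊤ C d)) p ⟨hpS, hpG, rfl⟩)
    refine Metric.le_infEDist.2 fun z hz => ?_
    have hcl : closure {x : RealPts n | x ∈ (⊤ : Submodule ℝ (RealPts n)) ∧ x.1 = (d : ℝ) ∧ x ∉ C} ⊆
        {z | d * (δ / 2) ≤ dist (realPt p) z} := by
      refine closure_minimal ?_ (isClosed_le continuous_const (continuous_const.dist continuous_id))
      rintro ⟨h, y⟩ ⟨_, hh, hy⟩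
      simp only at hh
      subst hh
      have h1 := hfar y hy
      have h2 : ‖y - (d : ℝ) • x‖ ≤ ‖realVec (d • A.2 + t) - y‖
          + ‖realVec (d • A.2 + t) - (d : ℝ) • x‖ := by
        rw [norm_sub_rev (realVec _) y]
        exact norm_sub_le_norm_sub_add_norm_sub _ _ _
      have h3 : dist (realPt p).2 y ≤ dist (realPt p) ((d : ℝ), y) := le_max_right _ _
      rw [hpr, dist_eq_norm] at h3
      rw [Set.mem_ofPred_eq, hpr]
      simp only at h3
      linarith
    rw [edist_dist]
    exact ENNReal.ofReal_le_ofReal (hcl hz.2)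
  rw [ENNReal.div_lt_iff (Or.inl (by exact_mod_cast hd0.ne')) (Or.inl (ENNReal.natCast_ne_top d))]
    at hd
  refine absurd hle (not_le.2 (hd.trans_le ?_))
  rw [← ENNReal.ofReal_natCast, ← ENNReal.ofReal_mul (by positivity), mul_comm]

/-- The fixed `ρ` makes the points approach the ray after division by `d`; the pair differing by
`t₀` recovers `t₀` from the group of `G`. -/
lemma eventually_exists {T : AddSubgroup (Fin n → ℤ)} {A : IntPts n} {S : Set (IntPts n)}
    {G : AddSubsemigroup (IntPts n)} (hS : HasType ⊤ ⊤ C T A S) (hSG : Approximates ⊤ C S G)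
    {x : EuclideanSpace ℝ (Fin n)} (hx : ((1 : ℝ), x) ∈ interior C) :
    ∃ ρ : ℝ, 0 < ρ ∧ ∀ t₀ ∈ T, ∀ᶠ d : ℕ in atTop, ∃ t ∈ T,
      ‖realVec (d • A.2 + t) - (d : ℝ) • x‖ ≤ ρ ∧ ((d : ℤ), d • A.2 + t) ∈ G ∧
        ((d : ℤ), d • A.2 + (t + t₀)) ∈ G := by
  obtain ⟨ρ, hρ, hcov⟩ := realVec_close hS.finiteIndex
  obtain ⟨ε, hε, hev⟩ := eventually_mem hS hSG hx
  refine ⟨ρ, hρ, fun t₀ ht₀ => ?_⟩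
  have hlarge : Tendsto (fun d : ℕ => (d : ℝ) * ε) atTop atTop :=
    tendsto_natCast_atTop_atTop.atTop_mul_const hε
  filter_upwards [hev, hlarge.eventually_gt_atTop (ρ + ‖realVec t₀‖)] with d hd hdl
  obtain ⟨t, ht, htv⟩ := hcov ((d : ℝ) • x - realVec (d • A.2))
  have h1 : ‖realVec (d • A.2 + t) - (d : ℝ) • x‖ ≤ ρ := by
    rw [realVec_add]
    convert htv using 2
    abel
  refine ⟨t, ht, h1, hd t ht (h1.trans_lt ?_), hd _ (T.add_mem ht ht₀) ?_⟩
  · linarith [norm_nonneg (realVec t₀)]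
  · rw [← add_assoc, realVec_add, add_sub_right_comm]
    exact (norm_add_le _ _).trans_lt (by linarith)

lemma genGroup_eq {T : AddSubgroup (Fin n → ℤ)} {A : IntPts n} {S : Set (IntPts n)}
    {G : AddSubsemigroup (IntPts n)} (hS : HasType ⊤ ⊤ C T A S) (hSG : Approximates ⊤ C S G)
    {x : EuclideanSpace ℝ (Fin n)} (hx : ((1 : ℝ), x) ∈ interior C) (p : IntPts n) :
    p ∈ genGroup G ↔ ∃ l : ℤ, ∃ t ∈ T, p = l • A + (0, t) := by
  obtain ⟨ρ, hρ, hev⟩ := eventually_exists hS hSG hx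
  constructor
  · have hle : genGroup G ≤
        AddSubgroup.zmultiples A ⊔ T.map (AddMonoidHom.inr ℤ (Fin n → ℤ)) := by
      rw [genGroup, AddSubgroup.closure_le]
      intro p hp
      have h1 := hSG.1 hp
      rw [hS.eq] at h1
      obtain ⟨_, l, t, ht, rfl⟩ := h1
      exact AddSubgroup.mem_sup.2 ⟨_, ⟨l, rfl⟩, _, ⟨t, ht, rfl⟩, rfl⟩
    intro hp
    obtain ⟨_, ⟨l, rfl⟩, _, ⟨t, ht, rfl⟩, rfl⟩ := AddSubgroup.mem_sup.1 (hle hp)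
    exact ⟨l, t, ht, rfl⟩
  · have hT : ∀ t ∈ T, ((0, t) : IntPts n) ∈ genGroup G := by
      intro t₀ ht₀
      obtain ⟨d, t, _, _, h1, h2⟩ := (hev t₀ ht₀).exists
      have := (genGroup G).sub_mem (mem_genGroup h2) (mem_genGroup h1)
      convert this using 1
      ext i <;> simp
    have hA : A ∈ genGroup G := by
      have h0 := hev 0 T.zero_mem
      -- Elements of `G` in the consecutive degrees `d` and `d + 1` differ by `A` plus an element of
      -- `T`.
      obtain ⟨d, ⟨t, ht, _, h1, _⟩, t', ht', _, h2, _⟩ :=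
        (h0.and ((tendsto_add_atTop_nat 1).eventually h0)).exists
      have h3 := (genGroup G).sub_mem ((genGroup G).sub_mem (mem_genGroup h2) (mem_genGroup h1))
        (hT _ (T.sub_mem ht' ht))
      convert h3 using 1
      ext i
      · simp [hS.degree]
      · simp
        ring
    rintro ⟨l, t, ht, rfl⟩
    exact (genGroup G).add_mem ((genGroup G).zsmul_mem hA l) (hT t ht)

/-- `C` is the closure of its interior, and every interior ray is a limit of rays through points of
`G`. -/
lemma eq_coneC {T : AddSubgroup (Fin n → ℤ)} {A : IntPts n} {S : Set (IntPts n)}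
    {G : AddSubsemigroup (IntPts n)} (hS : HasType ⊤ ⊤ C T A S) (hSG : Approximates ⊤ C S G) :
    C = coneC G := by
  have hC := hS.cone
  refine Set.Subset.antisymm ?_ (coneC_subset hC.isClosed hC.convex hC.zero_mem fun p hp => ?_)
  · have h1 := hC.convex.closure_interior_eq_closure_of_nonempty_interior hC.interior_nonempty
    rw [hC.isClosed.closure_eq] at h1
    rw [← h1]
    refine closure_minimal (fun q hq => ?_) (isClosed_coneC G)
    have hq0 := hC.pos_of_mem_interior hq
    have hq1 := hC.smul_mem_interior (inv_pos.2 hq0) hq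
    have hq2 : q.1⁻¹ • q = ((1 : ℝ), q.1⁻¹ • q.2) :=
      Prod.ext (inv_mul_cancel₀ hq0.ne') rfl
    rw [hq2] at hq1
    set x := q.1⁻¹ • q.2 with hx
    suffices hmem : ((1 : ℝ), x) ∈ coneC G by
      have h3 := smul_mem_coneC hq0.le hmem
      rwa [← hq2, smul_inv_smul₀ hq0.ne'] at h3
    obtain ⟨ρ, hρ, hev⟩ := eventually_exists hS hSG hq1
    rw [← (isClosed_coneC G).closure_eq, Metric.mem_closure_iff]
    intro δ hδ
    have hlarge : Tendsto (fun d : ℕ => (d : ℝ) * δ) atTop atTop :=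
      tendsto_natCast_atTop_atTop.atTop_mul_const hδ
    obtain ⟨d, ⟨t, _, ht, hG, _⟩, hdl, hd0⟩ := ((hev 0 T.zero_mem).and
      ((hlarge.eventually_gt_atTop ρ).and (eventually_gt_atTop 0))).exists
    have hd' : (0 : ℝ) < d := by exact_mod_cast hd0
    refine ⟨(d : ℝ)⁻¹ • realPt ((d : ℤ), d • A.2 + t),
      smul_mem_coneC (by positivity) (realPt_mem_coneC hG), ?_⟩
    have h4 : (d : ℝ)⁻¹ • realPt ((d : ℤ), d • A.2 + t)
        = ((1 : ℝ), (d : ℝ)⁻¹ • realVec (d • A.2 + t)) := by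
      refine Prod.ext ?_ rfl
      simp [realPt, hd'.ne']
    have h5 : (d : ℝ)⁻¹ • realVec (d • A.2 + t) - x
        = (d : ℝ)⁻¹ • (realVec (d • A.2 + t) - (d : ℝ) • x) := by
      rw [smul_sub, inv_smul_smul₀ hd'.ne']
    rw [h4, Prod.dist_eq, dist_self, max_lt_iff]
    refine ⟨hδ, ?_⟩
    rw [dist_comm, dist_eq_norm]
    simp only
    rw [h5, norm_smul, norm_inv, Real.norm_of_nonneg hd'.le, inv_mul_lt_iff₀ hd']
    exact ht.trans_lt hdl
  · have h1 := hSG.1 hp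
    rw [hS.eq] at h1
    exact h1.1

/-- An approximating semigroup is determined by `G`. -/
lemma eq_of_approximates {T : AddSubgroup (Fin n → ℤ)} {A : IntPts n} {S : Set (IntPts n)}
    {G : AddSubsemigroup (IntPts n)} (hS : HasType ⊤ ⊤ C T A S) (hSG : Approximates ⊤ C S G) :
    S = {p | realPt p ∈ coneC G ∧ p ∈ genGroup G} := by
  have hC := hS.cone
  obtain ⟨q, hq⟩ := hC.interior_nonempty
  have hq0 := hC.pos_of_mem_interior hq
  have hq1 := hC.smul_mem_interior (inv_pos.2 hq0) hq
  have hq2 : q.1⁻¹ • q = ((1 : ℝ), q.1⁻¹ • q.2) := Prod.ext (inv_mul_cancel₀ hq0.ne') rfl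
  rw [hq2] at hq1
  ext p
  rw [Set.mem_ofPred_eq, genGroup_eq hS hSG hq1, hS.eq, eq_coneC hS hSG]
  rfl

end IsPositiveCone

end Uniqueness

lemma convex_newtonBody {n : ℕ} {G : AddSubsemigroup (IntPts n)} : Convex ℝ (newtonBody G) := by
  intro x hx y hy s t hs ht hst
  have := convex_coneC G hx hy hs ht hst
  rwa [Prod.smul_mk, Prod.smul_mk, Prod.mk_add_mk, smul_eq_mul, smul_eq_mul, mul_one, mul_one,
    hst] at this

lemma spaceV_eq_top {n : ℕ} {G : AddSubsemigroup (IntPts n)} (hc : CompleteRank G) {A : IntPts n}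
    (hA1 : A.1 = 1) : spaceV G A = ⊤ := by
  obtain ⟨b⟩ := nonempty_basis_groupM hc
  refine Submodule.eq_top_of_finrank_eq ?_
  rw [finrank_spaceV b hA1, Module.finrank_prod, Module.finrank_self, finrank_euclideanSpace_fin,
    add_comm]

end NewtonBody

/-! ### The theorem. -/

theorem theorem10p9 (n : ℕ) :
    -- graded semigroups of complete rank and limited growth
    (∀ G : AddSubsemigroup (IntPts n), IsGraded G → CompleteRank G → LimitedGrowth G →
      ConicType G ∧
      ∃! S : Set (IntPts n), ∃ (C : Set (RealPts n)) (T : AddSubgroup (Fin n → ℤ)) (A : IntPts n),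
        HasType ⊤ ⊤ C T A S ∧ Approximates ⊤ C S G) ∧
    -- graded subsemigroups of such semigroups
    (∀ (G G₁ : AddSubsemigroup (IntPts n)) (k : ℕ), IsGraded G → IsGraded G₁ → CompleteRank G₁ →
      LimitedGrowth G₁ → G ≤ G₁ → Module.finrank ℤ (groupT G) = k →
      (IsCompact (newtonBody G) ∧ Convex ℝ (newtonBody G) ∧ (newtonBody G).Nonempty ∧
        Module.finrank ℝ (vectorSpan ℝ (newtonBody G)) = k) ∧
      FiniteSections G ∧
      Nonempty (Module.Basis (Fin k) ℤ (groupM G)) ∧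
      ∀ A ∈ G, A.1 = 1 →
        Module.finrank ℝ (spaceV G A) = k + 1 ∧
        IsPositiveCone (spaceV G A) (coneC G) ∧
        HasType (spaceV G A) (groupM G) (coneC G) (groupT G) A
          (typeSet (coneC G) (groupT G) A) ∧
        Approximates (spaceV G A) (coneC G) (typeSet (coneC G) (groupT G) A) G ∧
        ∀ b : Module.Basis (Fin k) ℤ (groupM G),
          Tendsto (fun d : ℕ => (hilbert G d : ℝ) / (d : ℝ) ^ k) atTop
            (𝓝 ((latticeVolume b (realVec A.2) (newtonBody G)).toReal /
              ((groupT G).relIndex (groupM G) : ℝ)))) := by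
  refine ⟨fun G hG hc hl => ?_, fun G G₁ k hG hG₁ hc₁ hl₁ hle hk => ?_⟩
  · obtain ⟨R, hR⟩ := exists_linear_bound hG hc hl
    obtain ⟨b⟩ := nonempty_basis_groupM hc
    obtain ⟨A, hA, hA1⟩ := hG.exists_degree_one
    have hV := spaceV_eq_top hc hA1
    have hcone := isPositiveCone_coneC b hG hA hA1 hR
    have htype := hasType_coneC b hG hA hA1 hR
    have happ := approximates_coneC b hG hA hA1 hR
    rw [hV] at hcone happ
    rw [hV, groupM_eq_top hc] at htype
    refine ⟨⟨coneC G, hcone, ?_⟩, typeSet (coneC G) (groupT G) A,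
      ⟨coneC G, groupT G, A, htype, happ⟩, ?_⟩
    · rintro _ ⟨p, hp, rfl⟩
      exact realPt_mem_coneC hp
    · rintro S ⟨C, T, A', hS, hSG⟩
      rw [IsPositiveCone.eq_of_approximates hS hSG, IsPositiveCone.eq_of_approximates htype happ]
  · obtain ⟨R, hR₁⟩ := exists_linear_bound hG₁ hc₁ hl₁
    -- The linear bound is all that is needed from the larger semigroup.
    have hR : ∀ p ∈ G, ‖realVec p.2‖ ≤ R * (p.1 : ℝ) := fun p hp => hR₁ p (hle hp)
    obtain ⟨b₀⟩ := nonempty_basis_saturation (groupT G) hk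
    obtain ⟨A₀, hA₀, hA₀1⟩ := hG.exists_degree_one
    refine ⟨⟨isCompact_newtonBody b₀ hG hA₀ hA₀1 hR, convex_newtonBody, ?_,
      finrank_vectorSpan_newtonBody b₀ hG hA₀ hA₀1 hR⟩, finiteSections b₀ hG hA₀ hA₀1 hR, ⟨b₀⟩,
      fun A hA hA1 => ⟨finrank_spaceV b₀ hA1, isPositiveCone_coneC b₀ hG hA hA1 hR,
        hasType_coneC b₀ hG hA hA1 hR, approximates_coneC b₀ hG hA hA1 hR,
        fun b => tendsto_hilbert_div b hG hA hA1 hR⟩⟩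
    refine ⟨realVec A₀.2, ?_⟩
    have h1 : realPt A₀ = ((1 : ℝ), realVec A₀.2) := by simp [realPt, hA₀1]
    change ((1 : ℝ), realVec A₀.2) ∈ coneC G
    rw [← h1]
    exact realPt_mem_coneC hA₀
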